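/- **Proposition (Continuous-displacement branching clusters lie in the $L^1$ regime).** Let $C$ be a rooted branching cluster on $\mathbb R$: its genealogy $\mathcal T$ is a random rooted tree, labelled by finite words over a countable alphabet and almost surely finite; the root is placed at $0$, every other vertex $v$ is placed at the sum $X_v$ of the displacements along the edges on the path from the root to $v$; and $C=\sum_{v\in\mathcal T}\delta_{X_v}$. Assume that, conditionally on $\mathcal T$, the edge displacements are independent and each has a Lebesgue density on $\mathbb R$ (which may depend on $\mathcal T$ and on the edge; densities concentrated on $(0,\infty)$ are allowed), and that $\mathbb E[C(\mathbb R)^3]<\infty$. Let $\nu>0$ and let $$N=\sum_j \vartheta_{U_j}C_j$$ be the stationary Poisson cluster process generated by $C$, where $\{U_j\}$ is a homogeneous Poisson process on $\mathbb R$ with rate $\nu$, the $C_j$ are i.i.d. copies of $C$ independent of $\{U_j\}$, and $\vartheta_u$ denotes translation by $u$. For bounded, compactly supported Borel functions $f_j$ on $\mathbb R$ let $\alpha_n(f_1,\dots,f_n)=\mathbb E\sum^{\ne}_{x_1,\dots,x_n\in N}\prod_j f_j(x_j)$ (sum over ordered $n$-tuples of distinct points of $N$) be the factorial moment measures, and let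 $$\kappa_3(f_0,f_1,f_2)=\alpha_3(f_0,f_1,f_2)-\alpha_2(f_0,f_1)\alpha_1(f_2)-\alpha_2(f_0,f_2)\alpha_1(f_1)-\alpha_2(f_1,f_2)\alpha_1(f_0)+2\,\alpha_1(f_0)\alpha_1(f_1)\alpha_1(f_2)$$ be the third factorial cumulant measure of $N$. The reduced third factorial cumulant measure of $N$ is the finite signed measure $\kappa_3^{\mathrm{red}}$ on $\mathbb R^2$ with $$\kappa_3(f_0,f_1,f_2)=\int_{\mathbb R}\int_{\mathbb R^2}f_0(t)\,f_1(t+\tau_1)\,f_2(t+\tau_2)\,\kappa_3^{\mathrm{red}}(d\tau_1,d\tau_2)\,dt .$$ Then $N$ has locally finite moment measures up to order three, the measure $\kappa_3^{\mathrm{red}}$ exists, and it is absolutely continuous with a density $c_3\in L^1(\mathbb R^2)$. Moreover, $$\int_{\mathbb R^2}c_3(\tau_1,\tau_2)\,d\tau_1\,d\tau_2=\nu\,\mathbb E\big[(C(\mathbb R))_3\big],\qquad (M)_3:=M(M-1)(M-2).$$ -/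

import Mathlib

open MeasureTheory ProbabilityTheory Set
open scoped NNReal ENNReal

noncomputable section

namespace PoissonCluster

/-! ### Factorial moments and third factorial cumulants of point processes on the line

A point process is a random counting measure `N : Ω → Measure ℝ` (points are counted with
multiplicity).  Below `∫ x, f x ∂N` is `N(f)`, the sum of `f` over the points of `N`. -/

/-- The sum of `f x * g y` over the ordered pairs of distinct points of the counting measure `N`:
all pairs, minus the pairs in which the same point occurs twice. -/
def pairSum (N : Measure ℝ) (f g : ℝ → ℝ) : ℝ :=
  (∫ x, f x ∂N) * (∫ x, g x ∂N) - ∫ x, f x * g x ∂N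

/-- The sum of `f x * g y * h z` over the ordered triples of pairwise distinct points of the
counting measure `N`, by inclusion-exclusion (see `tripleSum_sum_dirac`). -/
def tripleSum (N : Measure ℝ) (f g h : ℝ → ℝ) : ℝ :=
  (∫ x, f x ∂N) * (∫ x, g x ∂N) * (∫ x, h x ∂N)
    - (∫ x, f x * g x ∂N) * (∫ x, h x ∂N)
    - (∫ x, f x * h x ∂N) * (∫ x, g x ∂N)
    - (∫ x, g x * h x ∂N) * (∫ x, f x ∂N)
    + 2 * ∫ x, f x * g x * h x ∂N

/-- For labelled atoms, `tripleSum` is the sum over triples of pairwise distinct labels. -/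
theorem tripleSum_sum_dirac {ι : Type*} [DecidableEq ι] (s : Finset ι) (x : ι → ℝ)
    (f g h : ℝ → ℝ) :
    tripleSum (∑ i ∈ s, Measure.dirac (x i)) f g h =
      ∑ i ∈ s, ∑ j ∈ s, ∑ k ∈ s,
        if i ≠ j ∧ i ≠ k ∧ j ≠ k then f (x i) * g (x j) * h (x k) else 0 := by
  have key : ∀ φ : ℝ → ℝ, ∫ y, φ y ∂(∑ i ∈ s, Measure.dirac (x i)) = ∑ i ∈ s, φ (x i) := by
    intro φ
    rw [integral_finsetSum_measure (fun i _ => integrable_dirac (by simp))]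
    simp
  have hsplit : ∀ i j k : ι,
      (if i ≠ j ∧ i ≠ k ∧ j ≠ k then f (x i) * g (x j) * h (x k) else 0) =
        f (x i) * g (x j) * h (x k)
          - (if i = j then f (x i) * g (x i) * h (x k) else 0)
          - (if i = k then f (x i) * h (x i) * g (x j) else 0)
          - (if j = k then g (x j) * h (x j) * f (x i) else 0)
          + 2 * (if i = j then (if i = k then f (x i) * g (x i) * h (x i) else 0) else 0) := by
    intro i j k
    by_cases h1 : i = j <;> by_cases h2 : i = k <;> by_cases h3 : j = k <;>
      simp_all <;> ring
  simp only [tripleSum, key, hsplit, Finset.sum_add_distrib, Finset.sum_sub_distrib,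
    ← Finset.mul_sum]
  have e1 : ∑ i ∈ s, ∑ j ∈ s, ∑ k ∈ s, (if i = j then f (x i) * g (x i) * h (x k) else 0) =
      (∑ i ∈ s, f (x i) * g (x i)) * ∑ k ∈ s, h (x k) := by
    rw [Finset.sum_mul_sum]
    refine Finset.sum_congr rfl fun i hi => ?_
    rw [Finset.sum_comm]
    simp [hi]
  have e2 : ∑ i ∈ s, ∑ j ∈ s, ∑ k ∈ s, (if i = k then f (x i) * h (x i) * g (x j) else 0) =
      (∑ i ∈ s, f (x i) * h (x i)) * ∑ k ∈ s, g (x k) := by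
    rw [Finset.sum_mul_sum]
    refine Finset.sum_congr rfl fun i hi => ?_
    simp [hi]
  have e3 : ∑ i ∈ s, ∑ j ∈ s, ∑ k ∈ s, (if j = k then g (x j) * h (x j) * f (x i) else 0) =
      (∑ i ∈ s, g (x i) * h (x i)) * ∑ k ∈ s, f (x k) := by
    rw [Finset.sum_mul_sum, Finset.sum_comm]
    refine Finset.sum_congr rfl fun i hi => ?_
    simp [hi]
  have e4 : ∑ i ∈ s, ∑ j ∈ s, ∑ k ∈ s,
      (if i = j then (if i = k then f (x i) * g (x i) * h (x i) else 0) else 0) =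
      ∑ i ∈ s, f (x i) * g (x i) * h (x i) := by
    refine Finset.sum_congr rfl fun i hi => ?_
    rw [Finset.sum_comm]
    simp [hi]
  rw [e1, e2, e3, e4]
  simp only [← Finset.mul_sum, ← Finset.sum_mul]

section Moments

variable {Ω : Type*} [MeasurableSpace Ω]

/-- First factorial moment measure `α₁` of the point process `N`, tested against `f`. -/
def factorialMoment₁ (N : Ω → Measure ℝ) (μ : Measure Ω) (f : ℝ → ℝ) : ℝ :=
  ∫ ω, ∫ x, f x ∂(N ω) ∂μ

/-- Second factorial moment measure `α₂` of `N`, tested against `f ⊗ g`. -/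
def factorialMoment₂ (N : Ω → Measure ℝ) (μ : Measure Ω) (f g : ℝ → ℝ) : ℝ :=
  ∫ ω, pairSum (N ω) f g ∂μ

/-- Third factorial moment measure `α₃` of `N`, tested against `f ⊗ g ⊗ h`. -/
def factorialMoment₃ (N : Ω → Measure ℝ) (μ : Measure Ω) (f g h : ℝ → ℝ) : ℝ :=
  ∫ ω, tripleSum (N ω) f g h ∂μ

/-- Third factorial cumulant measure `κ₃` of `N`, tested against `f ⊗ g ⊗ h`: the coefficient of
`s₀ s₁ s₂` in the logarithm of the factorial moment generating functional
`E ∏ (1 + s₀ f + s₁ g + s₂ h) = 1 + s₀ α₁(f) + ⋯ + s₀ s₁ α₂(f, g) + ⋯ + s₀ s₁ s₂ α₃(f, g, h) + ⋯`,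
that is, its mixed derivative at the origin. -/
def thirdFactorialCumulant (N : Ω → Measure ℝ) (μ : Measure Ω) (f g h : ℝ → ℝ) : ℝ :=
  factorialMoment₃ N μ f g h
    - factorialMoment₂ N μ f g * factorialMoment₁ N μ h
    - factorialMoment₂ N μ f h * factorialMoment₁ N μ g
    - factorialMoment₂ N μ g h * factorialMoment₁ N μ f
    + 2 * (factorialMoment₁ N μ f * factorialMoment₁ N μ g * factorialMoment₁ N μ h)

/-- Bounded, compactly supported Borel test functions on the line. -/
structure IsTest (f : ℝ → ℝ) : Prop where
  measurable : Measurable f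
  bounded : ∃ b, ∀ x, |f x| ≤ b
  compact_support : HasCompactSupport f

/-- The finite signed measure `κ` on `ℝ²` is the reduced third factorial cumulant measure of the
point process `N`.  The first field says that the moment measures of `N` up to order three are
locally finite, so that `κ₃` is well defined; the second one is
`κ₃(dt₀, dt₁, dt₂) = κ(dτ₁, dτ₂) dt₀` with `t₁ = t₀ + τ₁`, `t₂ = t₀ + τ₂`. -/
structure IsReducedThirdFactorialCumulant (N : Ω → Measure ℝ) (μ : Measure Ω)
    (κ : SignedMeasure (ℝ × ℝ)) : Prop where
  moment_lt_top : ∀ K : Set ℝ, IsCompact K → ∫⁻ ω, (N ω K) ^ 3 ∂μ < ∞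
  disintegration : ∀ f₀ f₁ f₂ : ℝ → ℝ, IsTest f₀ → IsTest f₁ → IsTest f₂ →
    thirdFactorialCumulant N μ f₀ f₁ f₂ =
      ∫ t : ℝ, ∫ᵛ τ : ℝ × ℝ, f₀ t * f₁ (t + τ.1) * f₂ (t + τ.2) ∂<•κ

end Moments

/-! ### Rooted branching clusters

The vertices of the genealogy are labelled by finite words over `ℕ`; the root is the empty word and
the parent of `v ++ [i]` is `v`.  `T ω` is the set of vertices of the genealogy, and `D v ω` is the
displacement along the edge from the parent of `v` to `v`. -/

/-- Position of the vertex `v`: the sum of the displacements `D u` along the path from the root to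
`v`, where `u` runs over the nonempty prefixes of `v`.  The root is at the origin. -/
def position (D : List ℕ → ℝ) (v : List ℕ) : ℝ :=
  ∑ k ∈ Finset.range v.length, D (v.take (k + 1))

section Cluster

variable {Ω : Type*} [MeasurableSpace Ω]

/-- A random rooted tree `T` that is almost surely finite, together with edge displacements which,
conditionally on the tree, are independent and have Lebesgue densities (these densities may depend
on the tree and on the edge).  A finite tree takes countably many values, so conditioning on `T` is
conditioning on the events `T = τ` of positive probability. -/
structure IsBranchingCluster (T : Ω → Set (List ℕ)) (D : List ℕ → Ω → ℝ) (P : Measure Ω) :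
    Prop where
  measurable_tree : Measurable T
  measurable_displacement : ∀ v, Measurable (D v)
  root_mem : ∀ᵐ ω ∂P, [] ∈ T ω
  parent_mem : ∀ᵐ ω ∂P, ∀ (v : List ℕ) (i : ℕ), v ++ [i] ∈ T ω → v ∈ T ω
  finite : ∀ᵐ ω ∂P, (T ω).Finite
  indep : ∀ τ : Finset (List ℕ), P {ω | T ω = (τ : Set (List ℕ))} ≠ 0 →
    iIndepFun (fun (v : {v : List ℕ // v ∈ τ ∧ v ≠ []}) => D v)
      (P[|{ω | T ω = (τ : Set (List ℕ))}])
  density : ∀ τ : Finset (List ℕ), P {ω | T ω = (τ : Set (List ℕ))} ≠ 0 →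
    ∀ v ∈ τ, v ≠ [] → HasPDF (D v) (P[|{ω | T ω = (τ : Set (List ℕ))}]) volume

/-- The cluster `C` as a random counting measure: one unit atom at the position of each vertex. -/
def cluster (T : Ω → Set (List ℕ)) (D : List ℕ → Ω → ℝ) (ω : Ω) : Measure ℝ :=
  Measure.sum fun v : T ω => Measure.dirac (position (fun u => D u ω) v)

/-- `U` enumerates the points of a homogeneous Poisson process on the line with rate `ν`: the number
of points in a Borel set `B` of finite length is Poisson with mean `ν |B|`, and the numbers of
points in pairwise disjoint Borel sets of finite length are independent. -/
structure IsHomogeneousPoisson (U : ℕ → Ω → ℝ) (ν : ℝ≥0) (μ : Measure Ω) : Prop where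
  measurable : ∀ j, Measurable (U j)
  law : ∀ B : Set ℝ, MeasurableSet B → volume B ≠ ∞ →
    μ.map (fun ω => (Measure.sum fun j => Measure.dirac (U j ω)) B) =
      (poissonMeasure (ν * (volume B).toNNReal)).map (fun n : ℕ => (n : ℝ≥0∞))
  indep : ∀ (n : ℕ) (B : Fin n → Set ℝ), (∀ i, MeasurableSet (B i)) →
    (∀ i, volume (B i) ≠ ∞) → Pairwise (fun i j => Disjoint (B i) (B j)) →
    iIndepFun (fun i ω => (Measure.sum fun j => Measure.dirac (U j ω)) (B i)) μ

/-- The superposition `N = ∑ⱼ ϑ_{Uⱼ} Cⱼ` of the clusters `C j` translated to the points `U j`. -/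
def clusterProcess (U : ℕ → Ω → ℝ) (C : ℕ → Ω → Measure ℝ) (ω : Ω) : Measure ℝ :=
  Measure.sum fun j => (C j ω).map (fun x => x + U j ω)

/-- `U` and `C` are the immigrants and clusters of a stationary Poisson cluster process with
immigrant rate `ν` generated by the random measure `C₀` (defined on a probability space with
measure `P`): the `C j` are i.i.d. copies of `C₀`, independent of the Poisson process `U`. -/
structure IsPoissonClusterSystem {Ω₀ : Type*} [MeasurableSpace Ω₀] (U : ℕ → Ω → ℝ)
    (C : ℕ → Ω → Measure ℝ) (ν : ℝ≥0) (μ : Measure Ω) (C₀ : Ω₀ → Measure ℝ) (P : Measure Ω₀) :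
    Prop where
  poisson : IsHomogeneousPoisson U ν μ
  measurable_cluster : ∀ j, Measurable (C j)
  identDistrib : ∀ j, IdentDistrib (C j) C₀ μ P
  indep_clusters : iIndepFun C μ
  indep_immigrants : IndepFun (fun ω j => U j ω) (fun ω j => C j ω) μ

end Cluster

end PoissonCluster

end

/-!
The immigrants marked with their translated clusters form a Poisson process, whose factorial moment
measures are the powers `m ⊗ ⋯ ⊗ m` of its intensity measure. In the third factorial cumulant all
products of lower moments therefore cancel, and what is left is the contribution of triples of
distinct points of a single cluster.

Three such points are the positions of distinct vertices of the tree, so given the tree their two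
differences are linear forms in the independent displacements. The sets of edges on three distinct
root paths are distinct vertices of a cube, and no three vertices of a cube are collinear: the two
linear forms are linearly independent, and the pair of differences has a density.
-/

namespace PoissonCluster

section Embeddings

variable {ι : Type*}

/-- Injections with prescribed disjoint target sets amount to one injection per target set. -/
def embeddingIntoEquiv {α κ : Type*} {S : κ → Set ι} (hS : Pairwise fun q r => Disjoint (S q) (S r))
    (c : α → κ) :
    {p : α ↪ ι // ∀ i, p i ∈ S (c i)} ≃ ∀ q, ({i // c i = q} ↪ S q) where
  toFun p q := ⟨fun i => ⟨p.1 i, by simpa only [i.2] using p.2 i⟩, fun _ _ h =>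
    Subtype.ext (p.1.injective (congrArg Subtype.val h))⟩
  invFun e := ⟨⟨fun i => e (c i) ⟨i, rfl⟩, fun i j h => by
    have hij : c i = c j := by
      by_contra hne
      exact (hS hne).ne_of_mem (e (c i) ⟨i, rfl⟩).2 (e (c j) ⟨j, rfl⟩).2 h
    have key : ∀ q (hi : c i = q) (hj : c j = q),
        (e q ⟨i, hi⟩ : ι) = e q ⟨j, hj⟩ → i = j := fun q hi hj he =>
      congrArg Subtype.val ((e q).injective (Subtype.ext he))
    refine key (c j) hij rfl (Eq.trans ?_ h)
    clear key h
    generalize c j = q at hij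
    subst hij
    rfl⟩, fun i => (e (c i) ⟨i, rfl⟩).2⟩
  left_inv _ := rfl
  right_inv e := by
    ext q ⟨i, rfl⟩
    rfl

theorem encard_embedding_into {α κ : Type*} [Fintype α] [Fintype κ] [DecidableEq κ]
    {S : κ → Set ι} (hS : Pairwise fun q r => Disjoint (S q) (S r)) (hfin : ∀ q, (S q).Finite)
    (c : α → κ) :
    {p : α ↪ ι | ∀ i, p i ∈ S (c i)}.encard =
      ((∏ q, (S q).ncard.descFactorial (Fintype.card {i // c i = q}) : ℕ) : ℕ∞) := by
  have := fun q => (hfin q).fintype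
  classical
  refine (ENat.card_congr (embeddingIntoEquiv hS c)).trans ?_
  rw [ENat.card_eq_coe_natCard, Nat.card_pi]
  simp only [Nat.card_eq_fintype_card, Fintype.card_embedding_eq, ncard_eq_toFinset_card',
    toFinset_card]

variable {a b c : ι → ℝ}

theorem summable_mul_of_summable (ha : Summable a) (hb : Summable b) :
    Summable fun i => a i * b i :=
  (summable_mul_of_summable_norm ha.norm hb.norm).comp_injective
    (i := fun i : ι => (i, i)) fun _ _ h => (Prod.ext_iff.1 h).1

theorem hasSum_embedding_succ {n : ℕ} {A : (Fin n → ι) → ℝ}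
    (hA : Summable fun p : Fin n ↪ ι => A p) (hb : Summable b) :
    HasSum (fun q : Fin (n + 1) ↪ ι => b (q 0) * A (fun i => q i.succ))
      ((∑' j, b j) * (∑' p : Fin n ↪ ι, A p) - ∑ i, ∑' p : Fin n ↪ ι, b (p i) * A p) := by
  have hbA : Summable fun x : (Fin n ↪ ι) × ι => b x.2 * A x.1 :=
    (summable_mul_of_summable_norm hb.norm hA.norm).comp_injective Prod.swap_injective
  have hdiag : ∀ i, Summable fun p : Fin n ↪ ι => b (p i) * A p := fun i =>
    hbA.comp_injective (i := fun p : Fin n ↪ ι => (p, p i)) fun _ _ h => (Prod.ext_iff.1 h).1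
  refine (Equiv.embeddingFinSucc n ι).symm.hasSum_iff.1 ?_
  have hfibre : ∀ p : Fin n ↪ ι, HasSum (fun j : {j // j ∉ range p} => b j * A p)
      ((∑' j, b j) * A p - ∑ i, b (p i) * A p) := fun p => by
    have hrange : HasSum ((fun j => b j * A p) ∘ ((↑) : range p → ι)) (∑ i, b (p i) * A p) :=
      (Equiv.ofInjective p p.injective).hasSum_iff.1 (hasSum_fintype _)
    refine (hrange.hasSum_compl_iff (f := fun j => b j * A p)).2 ?_
    rw [add_sub_cancel]
    exact hb.hasSum.mul_right (A p)
  have htotal : HasSum (fun p : Fin n ↪ ι => (∑' j, b j) * A p - ∑ i, b (p i) * A p)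
      ((∑' j, b j) * (∑' p : Fin n ↪ ι, A p) - ∑ i, ∑' p : Fin n ↪ ι, b (p i) * A p) :=
    (hA.hasSum.mul_left _).sub (hasSum_sum fun i _ => (hdiag i).hasSum)
  refine HasSum.sigma_of_hasSum htotal hfibre (hbA.comp_injective
    (i := fun x : (Σ p : Fin n ↪ ι, {j // j ∉ range p}) => (x.1, (x.2 : ι))) ?_)
  rintro ⟨p, j⟩ ⟨q, k⟩ h
  obtain ⟨rfl, hjk⟩ := Prod.ext_iff.1 h
  exact congrArg _ (Subtype.ext hjk)

theorem hasSum_embedding_one {A : (Fin 1 → ι) → ℝ} {s : ℝ} :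
    HasSum (fun p : Fin 1 ↪ ι => A p) s ↔ HasSum (fun j => A fun _ => j) s := by
  rw [← (Equiv.uniqueEmbeddingEquivResult (α := Fin 1) (β := ι)).symm.hasSum_iff]
  rfl

theorem hasSum_embedding_two (ha : Summable a) (hb : Summable b) :
    HasSum (fun p : Fin 2 ↪ ι => a (p 0) * b (p 1))
      ((∑' j, a j) * (∑' j, b j) - ∑' j, a j * b j) := by
  have hone : ∀ {d : ι → ℝ}, Summable d → HasSum (fun p : Fin 1 ↪ ι => d (p 0)) (∑' j, d j) :=
    @fun d hd => (hasSum_embedding_one (A := fun p => d (p 0))).2 hd.hasSum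
  have h := hasSum_embedding_succ (A := fun p : Fin 1 → ι => b (p 0)) (hone hb).summable ha
  rwa [Fin.sum_univ_one, (hone hb).tsum_eq,
    (hone (summable_mul_of_summable ha hb)).tsum_eq] at h

theorem hasSum_embedding_three (ha : Summable a) (hb : Summable b) (hc : Summable c) :
    HasSum (fun p : Fin 3 ↪ ι => a (p 0) * b (p 1) * c (p 2))
      ((∑' j, a j) * (∑' j, b j) * (∑' j, c j)
        - (∑' j, a j * b j) * (∑' j, c j) - (∑' j, a j * c j) * (∑' j, b j)
        - (∑' j, b j * c j) * (∑' j, a j) + 2 * ∑' j, a j * b j * c j) := by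
  have hab := summable_mul_of_summable ha hb
  have hac := summable_mul_of_summable ha hc
  have h := hasSum_embedding_succ (A := fun p : Fin 2 → ι => b (p 0) * c (p 1))
    (hasSum_embedding_two hb hc).summable ha
  simp only [Fin.sum_univ_two, (hasSum_embedding_two hb hc).tsum_eq, Fin.succ_zero_eq_one,
    Fin.succ_one_eq_two, ← mul_assoc] at h
  have h₀ : ∑' p : Fin 2 ↪ ι, a (p 0) * b (p 0) * c (p 1) =
      (∑' j, a j * b j) * (∑' j, c j) - ∑' j, a j * b j * c j :=
    (hasSum_embedding_two hab hc).tsum_eq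
  have h₁ : ∑' p : Fin 2 ↪ ι, a (p 1) * b (p 0) * c (p 1) =
      (∑' j, b j) * (∑' j, a j * c j) - ∑' j, a j * b j * c j := by
    simp only [mul_comm (a _) (b _), mul_assoc]
    exact (hasSum_embedding_two hb hac).tsum_eq
  rw [h₀, h₁] at h
  convert h using 1
  ring

end Embeddings

section FactorialMomentMeasure

variable {Ω E ι : Type*} [MeasurableSpace Ω] [MeasurableSpace E] {μ : Measure Ω}

/-- The mean counting measure of the `n`-tuples of points `V j` with pairwise distinct labels `j` in
the random set `S`: the `n`-th factorial moment measure of the point process `∑_{j ∈ S} δ_{V j}`. -/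
noncomputable def factorialMomentMeasure (n : ℕ) (S : Ω → Set ι) (V : ι → Ω → E)
    (μ : Measure Ω) : Measure (Fin n → E) :=
  Measure.sum fun p : Fin n ↪ ι => (μ.restrict {ω | ∀ i, p i ∈ S ω}).map fun ω i => V (p i) ω

instance countable_embedding [Countable ι] (n : ℕ) : Countable (Fin n ↪ ι) :=
  DFunLike.coe_injective.countable

theorem ae_summable_of_tsum_lintegral_enorm [Countable ι] {F : ι → Ω → ℝ}
    (hF : ∀ j, AEStronglyMeasurable (F j) μ) (hsum : ∑' j, ∫⁻ ω, ‖F j ω‖ₑ ∂μ ≠ ∞) :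
    ∀ᵐ ω ∂μ, Summable fun j => F j ω := by
  simp only [← eLpNorm_one_eq_lintegral_enorm] at hsum
  filter_upwards [summable_norm_of_tsum_eLpNorm_ne_top le_rfl hF hsum] with ω hω using hω.of_norm

theorem integrable_tsum_of_tsum_lintegral_enorm [Countable ι] {F : ι → Ω → ℝ}
    (hF : ∀ j, AEStronglyMeasurable (F j) μ) (hsum : ∑' j, ∫⁻ ω, ‖F j ω‖ₑ ∂μ ≠ ∞) :
    Integrable (fun ω => ∑' j, F j ω) μ := by
  refine ⟨(AEMeasurable.tsum fun j => (hF j).aemeasurable).aestronglyMeasurable, ?_⟩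
  refine lt_of_le_of_lt ?_ hsum.lt_top
  rw [← lintegral_tsum fun j => (hF j).enorm]
  exact lintegral_mono fun ω => enorm_tsum_le_tsum_enorm

variable {n : ℕ} {S : Ω → Set ι} {V : ι → Ω → E}

theorem measurableSet_forall_mem (hS : Measurable S) (p : Fin n ↪ ι) :
    MeasurableSet {ω | ∀ i, p i ∈ S ω} := by
  rw [ofPred_forall]
  exact MeasurableSet.iInter fun i => hS (measurableSet_mem (p i))

theorem factorialMomentMeasure_univ (n : ℕ) (V : ι → Ω → E) (μ : Measure Ω) :
    factorialMomentMeasure n (fun _ => univ) V μ =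
      Measure.sum fun p : Fin n ↪ ι => μ.map fun ω i => V (p i) ω := by
  simp only [factorialMomentMeasure, mem_univ, implies_true, ofPred_true, Measure.restrict_univ]

theorem measurable_tuple (hV : ∀ j, Measurable (V j)) (p : Fin n ↪ ι) :
    Measurable fun ω i => V (p i) ω :=
  measurable_pi_lambda _ fun i => hV (p i)

theorem factorialMomentMeasure_apply [Countable ι] (hS : Measurable S)
    (hV : ∀ j, Measurable (V j)) {B : Set (Fin n → E)} (hB : MeasurableSet B) :
    factorialMomentMeasure n S V μ B =
      ∫⁻ ω, {p : Fin n ↪ ι | (∀ i, p i ∈ S ω) ∧ (fun i => V (p i) ω) ∈ B}.encard ∂μ := by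
  have hp : ∀ p : Fin n ↪ ι, MeasurableSet
      {ω | (∀ i, p i ∈ S ω) ∧ (fun i => V (p i) ω) ∈ B} := fun p =>
    (measurableSet_forall_mem hS p).inter (measurable_tuple hV p hB)
  have hcount : ∀ ω, ({p : Fin n ↪ ι | (∀ i, p i ∈ S ω) ∧
      (fun i => V (p i) ω) ∈ B}.encard : ℝ≥0∞) = ∑' p : Fin n ↪ ι,
        {ω | (∀ i, p i ∈ S ω) ∧ (fun i => V (p i) ω) ∈ B}.indicator 1 ω := fun ω => by
    rw [← ENNReal.tsum_set_one, tsum_subtype _ fun _ => (1 : ℝ≥0∞)]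
    rfl
  simp only [hcount]
  rw [lintegral_tsum fun p => (measurable_one.indicator (hp p)).aemeasurable,
    factorialMomentMeasure, Measure.sum_apply _ hB]
  refine tsum_congr fun p => ?_
  rw [lintegral_indicator_one (hp p), Measure.map_apply (measurable_tuple hV p) hB,
    Measure.restrict_apply (measurable_tuple hV p hB), inter_comm]
  rfl

section Integral

variable {F : (Fin n → E) → ℝ}

theorem tsum_lintegral_enorm_indicator_tuple (hS : Measurable S) (hV : ∀ j, Measurable (V j))
    (hF : Measurable F) :
    ∑' p : Fin n ↪ ι, ∫⁻ ω, ‖{ω | ∀ i, p i ∈ S ω}.indicator (fun ω => F fun i => V (p i) ω) ω‖ₑ ∂μ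
      = ∫⁻ x, ‖F x‖ₑ ∂factorialMomentMeasure n S V μ := by
  rw [factorialMomentMeasure, lintegral_sum_measure]
  refine tsum_congr fun p => ?_
  simp only [enorm_indicator_eq_indicator_enorm]
  rw [lintegral_indicator (measurableSet_forall_mem hS p),
    lintegral_map hF.enorm (measurable_tuple hV p)]

theorem measurable_indicator_tuple (hS : Measurable S) (hV : ∀ j, Measurable (V j))
    (hF : Measurable F) (p : Fin n ↪ ι) :
    Measurable ({ω | ∀ i, p i ∈ S ω}.indicator fun ω => F fun i => V (p i) ω) :=
  (hF.comp (measurable_tuple hV p)).indicator (measurableSet_forall_mem hS p)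

variable [Countable ι]

theorem ae_summable_indicator_tuple (hS : Measurable S) (hV : ∀ j, Measurable (V j))
    (hF : Measurable F) (hFi : Integrable F (factorialMomentMeasure n S V μ)) :
    ∀ᵐ ω ∂μ, Summable fun p : Fin n ↪ ι =>
      {ω | ∀ i, p i ∈ S ω}.indicator (fun ω => F fun i => V (p i) ω) ω :=
  ae_summable_of_tsum_lintegral_enorm
    (fun p => (measurable_indicator_tuple hS hV hF p).aestronglyMeasurable)
    ((tsum_lintegral_enorm_indicator_tuple hS hV hF).trans_lt hFi.2).ne

theorem integrable_tsum_indicator_tuple (hS : Measurable S) (hV : ∀ j, Measurable (V j))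
    (hF : Measurable F) (hFi : Integrable F (factorialMomentMeasure n S V μ)) :
    Integrable (fun ω => ∑' p : Fin n ↪ ι,
      {ω | ∀ i, p i ∈ S ω}.indicator (fun ω => F fun i => V (p i) ω) ω) μ :=
  integrable_tsum_of_tsum_lintegral_enorm
    (fun p => (measurable_indicator_tuple hS hV hF p).aestronglyMeasurable)
    ((tsum_lintegral_enorm_indicator_tuple hS hV hF).trans_lt hFi.2).ne

theorem integral_tsum_indicator_tuple (hS : Measurable S) (hV : ∀ j, Measurable (V j))
    (hF : Measurable F) (hFi : Integrable F (factorialMomentMeasure n S V μ)) :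
    ∫ ω, ∑' p : Fin n ↪ ι, {ω | ∀ i, p i ∈ S ω}.indicator (fun ω => F fun i => V (p i) ω) ω ∂μ =
      ∫ x, F x ∂factorialMomentMeasure n S V μ := by
  rw [integral_tsum (fun p => (measurable_indicator_tuple hS hV hF p).aestronglyMeasurable)
    ((tsum_lintegral_enorm_indicator_tuple hS hV hF).trans_lt hFi.2).ne, factorialMomentMeasure,
    integral_sum_measure hFi]
  refine tsum_congr fun p => ?_
  rw [integral_indicator (measurableSet_forall_mem hS p),
    integral_map (measurable_tuple hV p).aemeasurable hF.aestronglyMeasurable]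

end Integral

end FactorialMomentMeasure

section PoissonLaw

theorem poissonMeasure_singleton_succ (r : ℝ≥0) (n : ℕ) :
    ((n + 1 : ℕ) : ℝ≥0∞) * poissonMeasure r {n + 1} = r * poissonMeasure r {n} := by
  rw [poissonMeasure_singleton, poissonMeasure_singleton, ← ENNReal.ofReal_natCast,
    ← ENNReal.ofReal_coe_nnreal, ← ENNReal.ofReal_mul (by positivity),
    ← ENNReal.ofReal_mul (by positivity), Nat.factorial_succ]
  congr 1
  push_cast
  field_simp
  ring

theorem lintegral_descFactorial_poissonMeasure (r : ℝ≥0) (k : ℕ) :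
    ∫⁻ n, (n.descFactorial k : ℝ≥0∞) ∂poissonMeasure r = r ^ k := by
  induction k with
  | zero => simp
  | succ k ih =>
    rw [lintegral_countable', tsum_eq_zero_add' ENNReal.summable, pow_succ', ← ih,
      lintegral_countable', ← ENNReal.tsum_mul_left, Nat.zero_descFactorial_succ, Nat.cast_zero,
      zero_mul, zero_add]
    refine tsum_congr fun n => ?_
    rw [Nat.succ_descFactorial_succ, Nat.cast_mul, mul_right_comm,
      poissonMeasure_singleton_succ, mul_right_comm, mul_assoc]

end PoissonLaw

section ProductMeasure

variable {ι E : Type*}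

/-- The cells of the partition of `⋃ i, A i` generated by the sets `A i`: the points of `cell A v`
lie in `A i` exactly for the indices `i ∈ v`, and `cell A ∅` is empty. -/
def cell (A : ι → Set E) (v : Finset ι) : Set E :=
  {x | v.Nonempty ∧ ∀ i, x ∈ A i ↔ i ∈ v}

theorem disjoint_cell (A : ι → Set E) : Pairwise fun v w => Disjoint (cell A v) (cell A w) :=
  fun _ _ hvw => disjoint_left.2 fun _ hv hw =>
    hvw (Finset.ext fun i => (hv.2 i).symm.trans (hw.2 i))

theorem iUnion_cell [Fintype ι] [DecidableEq ι] (A : ι → Set E) (i : ι) :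
    ⋃ v ∈ Finset.univ.filter fun v : Finset ι => i ∈ v, cell A v = A i := by
  classical
  ext x
  simp only [Finset.mem_filter, Finset.mem_univ, true_and, mem_iUnion, exists_prop]
  refine ⟨fun ⟨v, hv, hx⟩ => (hx.2 i).2 hv, fun hx => ⟨Finset.univ.filter fun j => x ∈ A j, ?_⟩⟩
  have hmem : i ∈ Finset.univ.filter fun j => x ∈ A j := by simpa using hx
  exact ⟨hmem, ⟨i, hmem⟩, fun j => by simp⟩

theorem iUnion_pi_cell [Fintype ι] [DecidableEq ι] (A : ι → Set E) :
    ⋃ c ∈ Fintype.piFinset fun i => Finset.univ.filter fun v : Finset ι => i ∈ v,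
      univ.pi (fun i => cell A (c i)) = univ.pi A := by
  ext x
  have hA : ∀ i, x i ∈ A i ↔ ∃ v : Finset ι, i ∈ v ∧ x i ∈ cell A v := fun i => by
    conv_lhs => rw [← iUnion_cell A i]
    simp
  simp only [mem_iUnion, Fintype.mem_piFinset, Finset.mem_filter, Finset.mem_univ, true_and,
    exists_prop, mem_univ_pi, hA, Classical.skolem, ← forall_and]

variable [mE : MeasurableSpace E]

theorem measurableSet_cell [Countable ι] {A : ι → Set E} (hA : ∀ i, MeasurableSet (A i))
    (v : Finset ι) : MeasurableSet (cell A v) := by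
  refine (MeasurableSet.const _).inter (s₂ := {x | ∀ i, x ∈ A i ↔ i ∈ v}) ?_
  rw [ofPred_forall]
  refine MeasurableSet.iInter fun i => ?_
  by_cases hi : i ∈ v
  · simp only [hi, iff_true]
    exact hA i
  · simp only [hi, iff_false]
    exact (hA i).compl

variable {m : Measure E}

theorem measure_cell_ne_top {A : ι → Set E} (hA : ∀ i, m (A i) ≠ ∞) (v : Finset ι) :
    m (cell A v) ≠ ∞ := by
  rcases v.eq_empty_or_nonempty with rfl | ⟨i, hi⟩
  · simp [cell]
  · exact measure_ne_top_of_subset (fun x hx => (hx.2 i).2 hi) (hA i)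

theorem generateFrom_finite_measure [SigmaFinite m] :
    MeasurableSpace.generateFrom {s : Set E | MeasurableSet s ∧ m s ≠ ∞} = mE := by
  refine le_antisymm (MeasurableSpace.generateFrom_le fun s hs => hs.1) fun s hs => ?_
  have hunion : s = ⋃ n, s ∩ spanningSets m n := by
    rw [← inter_iUnion, iUnion_spanningSets, inter_univ]
  rw [hunion]
  exact MeasurableSet.iUnion fun n => MeasurableSpace.measurableSet_generateFrom
    ⟨hs.inter (measurableSet_spanningSets m n),
      measure_ne_top_of_subset inter_subset_right (measure_spanningSets_lt_top m n).ne⟩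

theorem isPiSystem_finite_measure : IsPiSystem {s : Set E | MeasurableSet s ∧ m s ≠ ∞} :=
  fun _ hs _ ht _ => ⟨hs.1.inter ht.1, measure_ne_top_of_subset inter_subset_left hs.2⟩

/-- The spanning sets of a `σ`-finite measure, as measurable sets of finite measure. -/
noncomputable def finiteMeasureSpanning (m : Measure E) [SigmaFinite m] :
    m.FiniteSpanningSetsIn {s : Set E | MeasurableSet s ∧ m s ≠ ∞} where
  set := spanningSets m
  set_mem n := ⟨measurableSet_spanningSets m n, (measure_spanningSets_lt_top m n).ne⟩
  finite := measure_spanningSets_lt_top m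
  spanning := iUnion_spanningSets m

theorem pi_eq_of_eq_or_disjoint [Fintype ι] [SigmaFinite m] {M : Measure (ι → E)}
    (hM : ∀ A : ι → Set E, (∀ i, MeasurableSet (A i)) → (∀ i, m (A i) ≠ ∞) →
      (∀ i j, A i = A j ∨ Disjoint (A i) (A j)) → M (univ.pi A) = ∏ i, m (A i)) :
    M = Measure.pi fun _ => m := by
  classical
  refine (Measure.pi_eq_generateFrom (fun _ => generateFrom_finite_measure)
    (fun _ => isPiSystem_finite_measure) (fun _ => finiteMeasureSpanning m) fun A hA => ?_).symm
  have hcell := measurableSet_cell fun i => (hA i).1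
  have hpi : M (univ.pi A) = ∑ c ∈ Fintype.piFinset fun i =>
      Finset.univ.filter fun v : Finset ι => i ∈ v, ∏ i, m (cell A (c i)) := by
    rw [← iUnion_pi_cell A, measure_biUnion_finset]
    · refine Finset.sum_congr rfl fun c _ => hM _ (fun i => hcell _)
        (fun i => measure_cell_ne_top (fun i => (hA i).2) _) fun i j => ?_
      by_cases hij : c i = c j
      · exact Or.inl (by rw [hij])
      · exact Or.inr (disjoint_cell A hij)
    · intro c _ d _ hcd
      obtain ⟨i, hi⟩ := Function.ne_iff.1 hcd
      exact disjoint_univ_pi.2 ⟨i, disjoint_cell A hi⟩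
    · exact fun c _ => MeasurableSet.univ_pi fun i => hcell _
  refine (hpi.trans (Finset.prod_univ_sum _ fun _ v => m (cell A v)).symm).trans ?_
  refine Finset.prod_congr rfl fun i _ => ?_
  rw [← measure_biUnion_finset (fun v _ w _ hvw => disjoint_cell A hvw) fun v _ => hcell v,
    iUnion_cell]

end ProductMeasure

theorem sum_dirac_apply {ι E : Type*} [MeasurableSpace E] (x : ι → E) {B : Set E}
    (hB : MeasurableSet B) :
    (Measure.sum fun j => Measure.dirac (x j)) B = ({j | x j ∈ B}.encard : ℝ≥0∞) := by
  rw [Measure.sum_apply _ hB, ← ENNReal.tsum_set_one, tsum_subtype _ fun _ => (1 : ℝ≥0∞)]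
  exact tsum_congr fun j => Measure.dirac_apply' _ hB

theorem natCast_descFactorial_eq_prod (n k : ℕ) :
    (n.descFactorial k : ℝ≥0∞) = ∏ i ∈ Finset.range k, ((n : ℝ≥0∞) - i) := by
  rw [Nat.descFactorial_eq_prod_range, Nat.cast_prod]
  exact Finset.prod_congr rfl fun i _ => ENNReal.natCast_sub n i

namespace IsHomogeneousPoisson

variable {Ω : Type*} [MeasurableSpace Ω] {U : ℕ → Ω → ℝ} {ν : ℝ≥0} {μ : Measure Ω}
  (h : IsHomogeneousPoisson U ν μ)

include h

theorem measurable_encard {B : Set ℝ} (hB : MeasurableSet B) :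
    Measurable fun ω => ({j | U j ω ∈ B}.encard : ℝ≥0∞) := by
  simp only [← sum_dirac_apply (fun j => U j _) hB, Measure.sum_apply _ hB]
  exact Measurable.tsum fun j => (Measure.measurable_coe hB).comp
    (Measure.measurable_dirac.comp (h.measurable j))

theorem lintegral_comp_encard {B : Set ℝ} (hB : MeasurableSet B) (hBv : volume B ≠ ∞)
    {g : ℝ≥0∞ → ℝ≥0∞} (hg : Measurable g) :
    ∫⁻ ω, g {j | U j ω ∈ B}.encard ∂μ =
      ∫⁻ n : ℕ, g n ∂poissonMeasure (ν * (volume B).toNNReal) := by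
  have hlaw := congrArg (fun ρ => ∫⁻ x, g x ∂ρ) (h.law B hB hBv)
  simp only [sum_dirac_apply _ hB] at hlaw
  rwa [lintegral_map hg (h.measurable_encard hB), lintegral_map hg (by fun_prop)] at hlaw

theorem lintegral_descFactorial_encard {B : Set ℝ} (hB : MeasurableSet B) (hBv : volume B ≠ ∞)
    (k : ℕ) :
    ∫⁻ ω, ∏ i ∈ Finset.range k, (({j | U j ω ∈ B}.encard : ℝ≥0∞) - i) ∂μ =
      (ν • volume : Measure ℝ) B ^ k := by
  rw [h.lintegral_comp_encard hB hBv (g := fun x => ∏ i ∈ Finset.range k, (x - i)) (by fun_prop)]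
  simp only [← natCast_descFactorial_eq_prod]
  rw [lintegral_descFactorial_poissonMeasure, ENNReal.coe_mul, ENNReal.coe_toNNReal hBv]
  rfl

theorem ae_finite {B : Set ℝ} (hB : MeasurableSet B) (hBv : volume B ≠ ∞) :
    ∀ᵐ ω ∂μ, {j | U j ω ∈ B}.Finite := by
  have hmean := h.lintegral_descFactorial_encard hB hBv 1
  simp only [Finset.range_one, Finset.prod_singleton, Nat.cast_zero, tsub_zero, pow_one] at hmean
  have hfin : (ν • volume : Measure ℝ) B ≠ ∞ := ENNReal.mul_ne_top ENNReal.coe_ne_top hBv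
  filter_upwards [ae_lt_top (h.measurable_encard hB) (hmean.trans_ne hfin)] with ω hω
  simpa using hω

theorem lintegral_encard_embedding {k n : ℕ} {B : Fin k → Set ℝ} (hB : ∀ q, MeasurableSet (B q))
    (hBv : ∀ q, volume (B q) ≠ ∞) (hdisj : Pairwise fun q r => Disjoint (B q) (B r))
    (c : Fin n → Fin k) :
    ∫⁻ ω, ({p : Fin n ↪ ℕ | ∀ i, U (p i) ω ∈ B (c i)}.encard : ℝ≥0∞) ∂μ =
      ∏ i, (ν • volume : Measure ℝ) (B (c i)) := by
  have hcount : ∀ᵐ ω ∂μ, ({p : Fin n ↪ ℕ | ∀ i, U (p i) ω ∈ B (c i)}.encard : ℝ≥0∞) =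
      ∏ q, ∏ i ∈ Finset.range (Fintype.card {i // c i = q}),
        (({j | U j ω ∈ B q}.encard : ℝ≥0∞) - i) := by
    filter_upwards [ae_all_iff.2 fun q => h.ae_finite (hB q) (hBv q)] with ω hω
    have hS : Pairwise fun q r => Disjoint {j | U j ω ∈ B q} {j | U j ω ∈ B r} :=
      fun q r hqr => (hdisj hqr).preimage fun j => U j ω
    rw [show {p : Fin n ↪ ℕ | ∀ i, U (p i) ω ∈ B (c i)}.encard = _ from
      encard_embedding_into hS hω c, ENat.toENNReal_coe, Nat.cast_prod]
    refine Finset.prod_congr rfl fun q _ => ?_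
    rw [natCast_descFactorial_eq_prod, ← (hω q).cast_ncard_eq, ENat.toENNReal_coe]
  have hindep : iIndepFun (fun q ω => ({j | U j ω ∈ B q}.encard : ℝ≥0∞)) μ := by
    simpa only [sum_dirac_apply _ (hB _)] using h.indep k B hB hBv hdisj
  have hg : ∀ q, Measurable fun x : ℝ≥0∞ =>
      ∏ i ∈ Finset.range (Fintype.card {i // c i = q}), (x - i) := fun q => by fun_prop
  refine (lintegral_congr_ae hcount).trans <| (lintegral_prod_eq_prod_lintegral_of_indepFun _ _
    (hindep.comp _ hg) fun q => (hg q).comp (h.measurable_encard (hB q))).trans <|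
    Eq.trans ?_ (Fintype.prod_fiberwise' c fun q => (ν • volume : Measure ℝ) (B q))
  refine Finset.prod_congr rfl fun q _ => ?_
  rw [Finset.prod_const, Finset.card_univ]
  exact h.lintegral_descFactorial_encard (hB q) (hBv q) _

theorem factorialMomentMeasure_eq_pi (hν : ν ≠ 0) (n : ℕ) :
    factorialMomentMeasure n (fun _ => univ) U μ = Measure.pi fun _ => ν • volume := by
  refine pi_eq_of_eq_or_disjoint fun A hA hAv hdisj => ?_
  have hvol : ∀ i, volume (A i) ≠ ∞ := fun i hi => hAv i <| by
    rw [Measure.smul_apply, hi, ENNReal.smul_top, if_neg hν]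
  classical
  let e : range A ≃ Fin (Fintype.card (range A)) := Fintype.equivFin _
  have hB : ∀ q, ∃ i, A i = (e.symm q : Set ℝ) := fun q => (e.symm q).2
  choose r hr using hB
  have hmoment := h.lintegral_encard_embedding (B := A ∘ r) (fun q => hA _) (fun q => hvol _)
    (fun q q' hqq' => (hdisj _ _).resolve_left fun hA' => hqq' <| e.symm.injective <|
      Subtype.ext ((hr q).symm.trans (hA'.trans (hr q')))) fun i => e ⟨A i, mem_range_self i⟩
  simp only [Function.comp_apply, hr, Equiv.symm_apply_apply] at hmoment
  rw [factorialMomentMeasure_apply measurable_const h.measurable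
    (MeasurableSet.univ_pi fun i => hA i), ← hmoment]
  simp only [mem_univ, implies_true, true_and, mem_univ_pi]

end IsHomogeneousPoisson

section Marking

variable {Ω α β : Type*} [MeasurableSpace Ω] [MeasurableSpace α] [MeasurableSpace β]
  {μ : Measure Ω} {V : ℕ → Ω → α} {m : Measure α} {C : ℕ → Ω → β} {L : Measure β}

/-- The points `V j` have the factorial moment measures `m ⊗ ⋯ ⊗ m` of a Poisson process with
intensity measure `m`; the cumulants of a cluster process depend on its immigrants only through
these. -/
structure HasPoissonFactorialMoments (V : ℕ → Ω → α) (μ : Measure Ω) (m : Measure α) : Prop where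
  measurable : ∀ j, Measurable (V j)
  factorialMomentMeasure_eq : ∀ n,
    factorialMomentMeasure n (fun _ => univ) V μ = Measure.pi fun _ => m

theorem IsHomogeneousPoisson.hasPoissonFactorialMoments {U : ℕ → Ω → ℝ} {ν : ℝ≥0}
    (h : IsHomogeneousPoisson U ν μ) (hν : ν ≠ 0) :
    HasPoissonFactorialMoments U μ (ν • volume) :=
  ⟨h.measurable, h.factorialMomentMeasure_eq_pi hν⟩

theorem map_tuple_prodMk [IsProbabilityMeasure μ] (hV : ∀ j, Measurable (V j))
    (hC : ∀ j, Measurable (C j)) (hlaw : ∀ j, μ.map (C j) = L) (hindep : iIndepFun C μ)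
    (hVC : IndepFun (fun ω j => V j ω) (fun ω j => C j ω) μ) {n : ℕ} (p : Fin n ↪ ℕ) :
    (μ.map fun ω i => (V (p i) ω, C (p i) ω)).map
        (MeasurableEquiv.arrowProdEquivProdArrow α β (Fin n)) =
      (μ.map fun ω i => V (p i) ω).prod (Measure.pi fun _ => L) := by
  have hCp := (iIndepFun_iff_map_fun_eq_pi_map fun i => (hC (p i)).aemeasurable).1
    (hindep.precomp p.injective)
  simp only [hlaw] at hCp
  have hVCp : IndepFun (fun ω i => V (p i) ω) (fun ω i => C (p i) ω) μ :=
    hVC.comp (measurable_pi_lambda (fun v i => v (p i)) fun i => measurable_pi_apply (p i))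
      (measurable_pi_lambda (fun c i => c (p i)) fun i => measurable_pi_apply (p i))
  rw [← hCp, ← hVCp.map_prod_eq_prod_map_map (measurable_tuple hV p).aemeasurable
    (measurable_tuple hC p).aemeasurable, Measure.map_map (MeasurableEquiv.measurable _)
    (measurable_tuple (fun j => (hV j).prodMk (hC j)) p)]
  rfl

theorem HasPoissonFactorialMoments.prodMk [IsProbabilityMeasure μ] [SigmaFinite m]
    [IsProbabilityMeasure L] (h : HasPoissonFactorialMoments V μ m) (hC : ∀ j, Measurable (C j))
    (hlaw : ∀ j, μ.map (C j) = L) (hindep : iIndepFun C μ)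
    (hVC : IndepFun (fun ω j => V j ω) (fun ω j => C j ω) μ) :
    HasPoissonFactorialMoments (fun j ω => (V j ω, C j ω)) μ (m.prod L) where
  measurable j := (h.measurable j).prodMk (hC j)
  factorialMomentMeasure_eq n := by
    refine (MeasurableEquiv.arrowProdEquivProdArrow α β (Fin n)).map_measurableEquiv_injective ?_
    rw [(measurePreserving_arrowProdEquivProdArrow α β (Fin n) (fun _ => m) fun _ => L).map_eq,
      ← h.factorialMomentMeasure_eq n, factorialMomentMeasure_univ, factorialMomentMeasure_univ,
      Measure.map_sum (MeasurableEquiv.measurable _).aemeasurable, Measure.prod_sum_left]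
    exact congrArg _ (funext fun p => map_tuple_prodMk h.measurable hC hlaw hindep hVC p)

theorem IsPoissonClusterSystem.hasPoissonFactorialMoments {Ω₀ : Type*} [MeasurableSpace Ω₀]
    {U : ℕ → Ω → ℝ} {C : ℕ → Ω → Measure ℝ} {ν : ℝ≥0} [IsProbabilityMeasure μ]
    {C₀ : Ω₀ → Measure ℝ} {P : Measure Ω₀} [IsProbabilityMeasure P]
    (h : IsPoissonClusterSystem U C ν μ C₀ P) (hν : ν ≠ 0) :
    HasPoissonFactorialMoments (fun j ω => (U j ω, C j ω)) μ ((ν • volume).prod (P.map C₀)) := by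
  have := Measure.isProbabilityMeasure_map (μ := P) (h.identDistrib 0).aemeasurable_snd
  exact (h.poisson.hasPoissonFactorialMoments hν).prodMk h.measurable_cluster
    (fun j => (h.identDistrib j).map_eq) h.indep_clusters h.indep_immigrants

end Marking

section Expectation

variable {Ω : Type*} [MeasurableSpace Ω] {X Y : Ω → ℝ} {μ : Measure Ω} {a b : ℝ}

/-- The random variable `X` is integrable with mean `a`. -/
def HasExpectation (X : Ω → ℝ) (μ : Measure Ω) (a : ℝ) : Prop :=
  Integrable X μ ∧ ∫ ω, X ω ∂μ = a

theorem HasExpectation.add (hX : HasExpectation X μ a) (hY : HasExpectation Y μ b) :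
    HasExpectation (fun ω => X ω + Y ω) μ (a + b) :=
  ⟨hX.1.add hY.1, by rw [integral_add hX.1 hY.1, hX.2, hY.2]⟩

theorem HasExpectation.congr_ae (hX : HasExpectation X μ a) (hXY : ∀ᵐ ω ∂μ, Y ω = X ω) :
    HasExpectation Y μ a :=
  ⟨hX.1.congr (hXY.mono fun _ h => h.symm), (integral_congr_ae hXY).trans hX.2⟩

end Expectation

namespace HasPoissonFactorialMoments

variable {Ω E : Type*} [MeasurableSpace Ω] [MeasurableSpace E] {μ : Measure Ω} {V : ℕ → Ω → E}
  {m : Measure E} [SigmaFinite m] (h : HasPoissonFactorialMoments V μ m) {φ ψ χ : E → ℝ}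

include h

theorem hasExpectation_tsum_prod {n : ℕ} {φ : Fin n → E → ℝ} (hφ : ∀ i, Measurable (φ i))
    (hφi : ∀ i, Integrable (φ i) m) :
    HasExpectation (fun ω => ∑' p : Fin n ↪ ℕ, ∏ i, φ i (V (p i) ω)) μ (∏ i, ∫ e, φ i e ∂m) := by
  have hF : Measurable fun x : Fin n → E => ∏ i, φ i (x i) := by fun_prop
  have hFi : Integrable (fun x : Fin n → E => ∏ i, φ i (x i))
      (factorialMomentMeasure n (fun _ => univ) V μ) := by
    rw [h.factorialMomentMeasure_eq]
    exact .fintype_prod hφi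
  have hinteg := integrable_tsum_indicator_tuple measurable_const h.measurable hF hFi
  have hmean := integral_tsum_indicator_tuple measurable_const h.measurable hF hFi
  simp only [mem_univ, implies_true, ofPred_true, indicator_univ] at hinteg hmean
  rw [h.factorialMomentMeasure_eq, integral_fintype_prod_eq_prod] at hmean
  exact ⟨hinteg, hmean⟩

theorem hasExpectation_tsum (hφ : Measurable φ) (hφi : Integrable φ m) :
    HasExpectation (fun ω => ∑' j, φ (V j ω)) μ (∫ e, φ e ∂m) := by
  have hsum := h.hasExpectation_tsum_prod (φ := fun _ : Fin 1 => φ) (fun _ => hφ) fun _ => hφi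
  simp only [Fin.prod_univ_one] at hsum
  refine hsum.congr_ae (.of_forall fun ω => ?_)
  exact ((Equiv.uniqueEmbeddingEquivResult (α := Fin 1) (β := ℕ)).tsum_eq
    fun j => φ (V j ω)).symm

theorem hasExpectation_tsum_mul (hφ : Measurable φ) (hψ : Measurable ψ) (hφi : Integrable φ m)
    (hψi : Integrable ψ m) :
    HasExpectation (fun ω => ∑' p : Fin 2 ↪ ℕ, φ (V (p 0) ω) * ψ (V (p 1) ω)) μ
      ((∫ e, φ e ∂m) * ∫ e, ψ e ∂m) := by
  have hsum := h.hasExpectation_tsum_prod (φ := ![φ, ψ]) (by simp [Fin.forall_fin_two, *])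
    (by simp [Fin.forall_fin_two, *])
  simp only [Fin.prod_univ_two] at hsum
  exact hsum

theorem hasExpectation_tsum_mul_mul (hφ : Measurable φ) (hψ : Measurable ψ) (hχ : Measurable χ)
    (hφi : Integrable φ m) (hψi : Integrable ψ m) (hχi : Integrable χ m) :
    HasExpectation
      (fun ω => ∑' p : Fin 3 ↪ ℕ, φ (V (p 0) ω) * ψ (V (p 1) ω) * χ (V (p 2) ω)) μ
      ((∫ e, φ e ∂m) * (∫ e, ψ e ∂m) * ∫ e, χ e ∂m) := by
  have hsum := h.hasExpectation_tsum_prod (φ := ![φ, ψ, χ])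
    (by simp [Fin.forall_fin_succ, *]) (by simp [Fin.forall_fin_succ, *])
  simp only [Fin.prod_univ_three] at hsum
  exact hsum

theorem ae_summable (hφ : Measurable φ) (hφi : Integrable φ m) :
    ∀ᵐ ω ∂μ, Summable fun j => φ (V j ω) := by
  have hFi : Integrable (fun x : Fin 1 → E => φ (x 0))
      (factorialMomentMeasure 1 (fun _ => univ) V μ) := by
    rw [h.factorialMomentMeasure_eq]
    simpa only [Fin.prod_univ_one] using Integrable.fintype_prod (f := fun _ : Fin 1 => φ)
      fun _ => hφi
  filter_upwards [ae_summable_indicator_tuple measurable_const h.measurable (by fun_prop) hFi]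
    with ω hω
  simp only [mem_univ, implies_true, ofPred_true, indicator_univ] at hω
  exact (Equiv.uniqueEmbeddingEquivResult (α := Fin 1) (β := ℕ)).summable_iff.1 hω

end HasPoissonFactorialMoments

section SumMeasure

variable {ι : Type*} {Q : ι → Measure ℝ} {f g h : ℝ → ℝ}

theorem pairSum_sum_measure (hf : Integrable f (Measure.sum Q)) (hg : Integrable g (Measure.sum Q))
    (hfg : Integrable (fun x => f x * g x) (Measure.sum Q)) :
    pairSum (Measure.sum Q) f g =
      ∑' p : Fin 2 ↪ ι, (∫ x, f x ∂Q (p 0)) * (∫ x, g x ∂Q (p 1)) + ∑' j, pairSum (Q j) f g := by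
  have hF := hasSum_integral_measure hf
  have hG := hasSum_integral_measure hg
  have hFG := hasSum_integral_measure hfg
  rw [(hasSum_embedding_two hF.summable hG.summable).tsum_eq, pairSum, ← hF.tsum_eq, ← hG.tsum_eq,
    ← hFG.tsum_eq]
  simp only [pairSum]
  rw [(summable_mul_of_summable hF.summable hG.summable).tsum_sub hFG.summable]
  ring

theorem tripleSum_sum_measure (hf : Integrable f (Measure.sum Q))
    (hg : Integrable g (Measure.sum Q)) (hh : Integrable h (Measure.sum Q))
    (hfg : Integrable (fun x => f x * g x) (Measure.sum Q))
    (hfh : Integrable (fun x => f x * h x) (Measure.sum Q))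
    (hgh : Integrable (fun x => g x * h x) (Measure.sum Q))
    (hfgh : Integrable (fun x => f x * g x * h x) (Measure.sum Q)) :
    tripleSum (Measure.sum Q) f g h =
      ∑' p : Fin 3 ↪ ι, (∫ x, f x ∂Q (p 0)) * (∫ x, g x ∂Q (p 1)) * (∫ x, h x ∂Q (p 2))
      + ∑' p : Fin 2 ↪ ι, pairSum (Q (p 0)) f g * (∫ x, h x ∂Q (p 1))
      + ∑' p : Fin 2 ↪ ι, pairSum (Q (p 0)) f h * (∫ x, g x ∂Q (p 1))
      + ∑' p : Fin 2 ↪ ι, pairSum (Q (p 0)) g h * (∫ x, f x ∂Q (p 1))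
      + ∑' j, tripleSum (Q j) f g h := by
  have hF := (hasSum_integral_measure hf).summable
  have hG := (hasSum_integral_measure hg).summable
  have hH := (hasSum_integral_measure hh).summable
  have hFG := (hasSum_integral_measure hfg).summable
  have hFH := (hasSum_integral_measure hfh).summable
  have hGH := (hasSum_integral_measure hgh).summable
  have hFGH := (hasSum_integral_measure hfgh).summable
  have hpair {a b c : ι → ℝ} (ha : Summable a) (hb : Summable b) (hc : Summable c) :
      HasSum (fun j => a j * b j - c j) (∑' j, a j * b j - ∑' j, c j) :=
    (summable_mul_of_summable ha hb).hasSum.sub hc.hasSum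
  have hmul {a b c d : ι → ℝ} (ha : Summable a) (hb : Summable b) (hc : Summable c)
      (hd : Summable d) :
      ∑' p : Fin 2 ↪ ι, (a (p 0) * b (p 0) - c (p 0)) * d (p 1) =
        (∑' j, a j * b j - ∑' j, c j) * ∑' j, d j
          - (∑' j, a j * b j * d j - ∑' j, c j * d j) := by
    rw [(hasSum_embedding_two (hpair ha hb hc).summable hd).tsum_eq, (hpair ha hb hc).tsum_eq]
    simp only [sub_mul]
    rw [(summable_mul_of_summable (summable_mul_of_summable ha hb) hd).tsum_sub
      (summable_mul_of_summable hc hd)]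
  have hdiag : HasSum (fun j => tripleSum (Q j) f g h) _ :=
    ((((summable_mul_of_summable (summable_mul_of_summable hF hG) hH).hasSum.sub
      (summable_mul_of_summable hFG hH).hasSum).sub
      (summable_mul_of_summable hFH hG).hasSum).sub
      (summable_mul_of_summable hGH hF).hasSum).add (hFGH.hasSum.mul_left 2)
  have hfgh' := (hasSum_embedding_three hF hG hH).tsum_eq
  simp only [pairSum]
  rw [hdiag.tsum_eq, hfgh', hmul hF hG hFG hH, hmul hF hH hFH hG, hmul hG hH hGH hF, tripleSum,
    ← (hasSum_integral_measure hf).tsum_eq, ← (hasSum_integral_measure hg).tsum_eq,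
    ← (hasSum_integral_measure hh).tsum_eq, ← (hasSum_integral_measure hfg).tsum_eq,
    ← (hasSum_integral_measure hfh).tsum_eq, ← (hasSum_integral_measure hgh).tsum_eq,
    ← (hasSum_integral_measure hfgh).tsum_eq]
  simp only [mul_right_comm _ (∫ x, h x ∂Q _) (∫ x, g x ∂Q _)]
  simp only [mul_comm (_ * _) (∫ x, f x ∂Q _), ← mul_assoc]
  ring

end SumMeasure

namespace IsTest

variable {f g : ℝ → ℝ}

theorem mul (hf : IsTest f) (hg : IsTest g) : IsTest fun x => f x * g x where
  measurable := hf.measurable.mul hg.measurable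
  bounded := by
    obtain ⟨b, hb⟩ := hf.bounded
    obtain ⟨c, hc⟩ := hg.bounded
    refine ⟨b * c, fun x => ?_⟩
    rw [abs_mul]
    exact mul_le_mul (hb x) (hc x) (abs_nonneg _) ((abs_nonneg _).trans (hb x))
  compact_support := hf.compact_support.mul_right

theorem abs (hf : IsTest f) : IsTest fun x => |f x| where
  measurable := hf.measurable.abs
  bounded := by simpa only [abs_abs] using hf.bounded
  compact_support := hf.compact_support.comp_left abs_zero

theorem exists_lintegral_enorm_le (hf : IsTest f) :
    ∃ (K : Set ℝ) (b : ℝ≥0), IsCompact K ∧ ∀ ρ : Measure ℝ, ∫⁻ x, ‖f x‖ₑ ∂ρ ≤ b * ρ K := by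
  obtain ⟨b, hb⟩ := hf.bounded
  refine ⟨tsupport f, b.toNNReal, hf.compact_support, fun ρ => ?_⟩
  rw [← lintegral_indicator_const hf.compact_support.measurableSet]
  refine lintegral_mono fun x => ?_
  by_cases hx : x ∈ tsupport f
  · rw [indicator_of_mem hx, Real.enorm_eq_ofReal_abs]
    exact ENNReal.ofReal_le_ofReal (hb x)
  · simp [image_eq_zero_of_notMem_tsupport hx]

theorem integrable (hf : IsTest f) (ρ : Measure ℝ) [IsFiniteMeasureOnCompacts ρ] :
    Integrable f ρ := by
  obtain ⟨K, b, hK, hb⟩ := hf.exists_lintegral_enorm_le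
  exact ⟨hf.measurable.aestronglyMeasurable,
    (hb ρ).trans_lt (ENNReal.mul_lt_top ENNReal.coe_lt_top hK.measure_lt_top)⟩

theorem indicator_one {K : Set ℝ} (hK : IsCompact K) : IsTest (K.indicator 1) where
  measurable := measurable_one.indicator hK.measurableSet
  bounded := ⟨1, fun x => by by_cases hx : x ∈ K <;> simp [hx]⟩
  compact_support := .intro hK fun _ hx => indicator_of_notMem hx _

end IsTest

section CompactMoments

variable {Ω E : Type*} [MeasurableSpace Ω] [MeasurableSpace E]

/-- A measurable family `Q` of finite measures on the line such that, under `m`, the mass that `Q`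
gives to a compact set has finite moments up to order three. The zeroth moment is excluded, as `m`
may be infinite. -/
structure HasCompactMoments (Q : E → Measure ℝ) (m : Measure E) : Prop where
  measurable : Measurable Q
  finite : ∀ e, IsFiniteMeasure (Q e)
  moment_lt_top : ∀ K, IsCompact K → ∀ p, p ≠ 0 → p ≤ 3 → ∫⁻ e, (Q e K) ^ p ∂m < ∞

namespace HasCompactMoments

section Marks

variable {m : Measure E} {Q : E → Measure ℝ} (hQ : HasCompactMoments Q m) {f g k : ℝ → ℝ}

include hQ

theorem measurable_integral (hf : Measurable f) : Measurable fun e => ∫ x, f x ∂Q e :=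
  (hf.stronglyMeasurable.integral_kernel (κ := (⟨Q, hQ.measurable⟩ : Kernel E ℝ))).measurable

theorem integrable_prod_integral {n : ℕ} (hn : n ≠ 0) (hn3 : n ≤ 3) {φ : Fin n → ℝ → ℝ}
    (hφ : ∀ i, IsTest (φ i)) : Integrable (fun e => ∏ i, ∫ x, φ i x ∂Q e) m := by
  choose K b hK hb using fun i => (hφ i).exists_lintegral_enorm_le
  have hle (e : E) : ‖∏ i, ∫ x, φ i x ∂Q e‖ₑ ≤ (∏ i, (b i : ℝ≥0∞)) * Q e (⋃ i, K i) ^ n := calc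
    ‖∏ i, ∫ x, φ i x ∂Q e‖ₑ = ∏ i, ‖∫ x, φ i x ∂Q e‖ₑ := by
      simp only [enorm_eq_nnnorm, nnnorm_prod, ENNReal.ofNNReal_finsetProd]
    _ ≤ ∏ i, (b i : ℝ≥0∞) * Q e (⋃ i, K i) := by
      gcongr with i
      exact (enorm_integral_le_lintegral_enorm _).trans <| (hb i _).trans <| by
        gcongr
        exact subset_iUnion K i
    _ = (∏ i, (b i : ℝ≥0∞)) * Q e (⋃ i, K i) ^ n := by
      rw [Finset.prod_mul_distrib, Finset.prod_const, Finset.card_univ, Fintype.card_fin]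
  have hb_ne_top : ∏ i, (b i : ℝ≥0∞) ≠ ∞ := ENNReal.prod_ne_top fun _ _ => ENNReal.coe_ne_top
  refine ⟨(Finset.univ.measurable_fun_prod fun i _ =>
    hQ.measurable_integral (hφ i).measurable).aestronglyMeasurable,
    (lintegral_mono hle).trans_lt ?_⟩
  rw [lintegral_const_mul' _ _ hb_ne_top]
  exact ENNReal.mul_lt_top hb_ne_top.lt_top (hQ.moment_lt_top _ (isCompact_iUnion hK) n hn hn3)

theorem integrable_integral (hf : IsTest f) : Integrable (fun e => ∫ x, f x ∂Q e) m := by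
  simpa only [Fin.prod_univ_one] using
    hQ.integrable_prod_integral (φ := fun _ : Fin 1 => f) one_ne_zero (by norm_num) fun _ => hf

theorem integrable_integral_mul (hf : IsTest f) (hg : IsTest g) :
    Integrable (fun e => (∫ x, f x ∂Q e) * ∫ x, g x ∂Q e) m := by
  have := hQ.integrable_prod_integral (φ := ![f, g]) two_ne_zero (by norm_num)
    (by simp [Fin.forall_fin_two, *])
  simp only [Fin.prod_univ_two] at this
  exact this

theorem integrable_integral_mul_mul (hf : IsTest f) (hg : IsTest g) (hk : IsTest k) :
    Integrable (fun e => (∫ x, f x ∂Q e) * (∫ x, g x ∂Q e) * ∫ x, k x ∂Q e) m := by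
  have := hQ.integrable_prod_integral (φ := ![f, g, k]) three_ne_zero le_rfl
    (by simp [Fin.forall_fin_succ, *])
  simp only [Fin.prod_univ_three] at this
  exact this

theorem integrable_pairSum (hf : IsTest f) (hg : IsTest g) :
    Integrable (fun e => pairSum (Q e) f g) m :=
  (hQ.integrable_integral_mul hf hg).sub (hQ.integrable_integral (hf.mul hg))

theorem integrable_tripleSum (hf : IsTest f) (hg : IsTest g) (hk : IsTest k) :
    Integrable (fun e => tripleSum (Q e) f g k) m :=
  ((((hQ.integrable_integral_mul_mul hf hg hk).sub (hQ.integrable_integral_mul (hf.mul hg) hk)).sub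
    (hQ.integrable_integral_mul (hf.mul hk) hg)).sub
    (hQ.integrable_integral_mul (hg.mul hk) hf)).add
    ((hQ.integrable_integral ((hf.mul hg).mul hk)).const_mul 2)

theorem measurable_pairSum (hf : Measurable f) (hg : Measurable g) :
    Measurable fun e => pairSum (Q e) f g :=
  ((hQ.measurable_integral hf).mul (hQ.measurable_integral hg)).sub
    (hQ.measurable_integral (hf.mul hg))

theorem measurable_tripleSum (hf : Measurable f) (hg : Measurable g) (hk : Measurable k) :
    Measurable fun e => tripleSum (Q e) f g k := by
  have hmf := hQ.measurable_integral hf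
  have hmg := hQ.measurable_integral hg
  have hmk := hQ.measurable_integral hk
  have hmfg := hQ.measurable_integral (hf.mul hg)
  have hmfk := hQ.measurable_integral (hf.mul hk)
  have hmgk := hQ.measurable_integral (hg.mul hk)
  have hmfgk := hQ.measurable_integral ((hf.mul hg).mul hk)
  exact ((((hmf.mul hmg).mul hmk).sub (hmfg.mul hmk)).sub (hmfk.mul hmg)).sub (hmgk.mul hmf)
    |>.add (hmfgk.const_mul 2)

end Marks

section Superposition

variable {m : Measure E} [SigmaFinite m] {μ : Measure Ω} {Q : E → Measure ℝ}
  (hQ : HasCompactMoments Q m) {V : ℕ → Ω → E} (hV : HasPoissonFactorialMoments V μ m)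
  {N : Ω → Measure ℝ} (hN : ∀ᵐ ω ∂μ, N ω = Measure.sum fun j => Q (V j ω)) {f g k : ℝ → ℝ}

include hQ hV hN

theorem ae_integrable (hf : IsTest f) : ∀ᵐ ω ∂μ, Integrable f (N ω) := by
  filter_upwards [hN, hV.ae_summable (hQ.measurable_integral hf.abs.measurable)
    (hQ.integrable_integral hf.abs)] with ω hω hsum
  rw [hω]
  have := hQ.finite
  refine integrable_sum_measure (fun j => hf.integrable _) ?_
  simpa only [Real.norm_eq_abs] using hsum

theorem hasExpectation_integral (hf : IsTest f) :
    HasExpectation (fun ω => ∫ x, f x ∂N ω) μ (∫ e, ∫ x, f x ∂Q e ∂m) := by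
  refine (hV.hasExpectation_tsum (hQ.measurable_integral hf.measurable)
    (hQ.integrable_integral hf)).congr_ae ?_
  filter_upwards [hN, hQ.ae_integrable hV hN hf] with ω hω hfi
  rw [hω] at hfi ⊢
  exact integral_sum_measure hfi

theorem hasExpectation_pairSum (hf : IsTest f) (hg : IsTest g) :
    HasExpectation (fun ω => pairSum (N ω) f g) μ
      ((∫ e, ∫ x, f x ∂Q e ∂m) * (∫ e, ∫ x, g x ∂Q e ∂m) + ∫ e, pairSum (Q e) f g ∂m) := by
  refine ((hV.hasExpectation_tsum_mul (hQ.measurable_integral hf.measurable)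
    (hQ.measurable_integral hg.measurable) (hQ.integrable_integral hf)
    (hQ.integrable_integral hg)).add (hV.hasExpectation_tsum
      (hQ.measurable_pairSum hf.measurable hg.measurable)
      (hQ.integrable_pairSum hf hg))).congr_ae ?_
  filter_upwards [hN, hQ.ae_integrable hV hN hf, hQ.ae_integrable hV hN hg,
    hQ.ae_integrable hV hN (hf.mul hg)] with ω hω hfi hgi hfgi
  rw [hω] at hfi hgi hfgi ⊢
  exact pairSum_sum_measure hfi hgi hfgi

theorem hasExpectation_tripleSum (hf : IsTest f) (hg : IsTest g) (hk : IsTest k) :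
    HasExpectation (fun ω => tripleSum (N ω) f g k) μ
      ((∫ e, ∫ x, f x ∂Q e ∂m) * (∫ e, ∫ x, g x ∂Q e ∂m) * (∫ e, ∫ x, k x ∂Q e ∂m)
        + (∫ e, pairSum (Q e) f g ∂m) * (∫ e, ∫ x, k x ∂Q e ∂m)
        + (∫ e, pairSum (Q e) f k ∂m) * (∫ e, ∫ x, g x ∂Q e ∂m)
        + (∫ e, pairSum (Q e) g k ∂m) * (∫ e, ∫ x, f x ∂Q e ∂m)
        + ∫ e, tripleSum (Q e) f g k ∂m) := by
  have hpair {a b c : ℝ → ℝ} (ha : IsTest a) (hb : IsTest b) (hc : IsTest c) :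
      HasExpectation
        (fun ω => ∑' p : Fin 2 ↪ ℕ, pairSum (Q (V (p 0) ω)) a b * ∫ x, c x ∂Q (V (p 1) ω)) μ
        ((∫ e, pairSum (Q e) a b ∂m) * ∫ e, ∫ x, c x ∂Q e ∂m) :=
    hV.hasExpectation_tsum_mul (hQ.measurable_pairSum ha.measurable hb.measurable)
      (hQ.measurable_integral hc.measurable) (hQ.integrable_pairSum ha hb)
      (hQ.integrable_integral hc)
  refine (((((hV.hasExpectation_tsum_mul_mul (hQ.measurable_integral hf.measurable)
    (hQ.measurable_integral hg.measurable) (hQ.measurable_integral hk.measurable)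
    (hQ.integrable_integral hf) (hQ.integrable_integral hg) (hQ.integrable_integral hk)).add
    (hpair hf hg hk)).add (hpair hf hk hg)).add (hpair hg hk hf)).add
    (hV.hasExpectation_tsum
      (hQ.measurable_tripleSum hf.measurable hg.measurable hk.measurable)
      (hQ.integrable_tripleSum hf hg hk))).congr_ae ?_
  filter_upwards [hN, hQ.ae_integrable hV hN hf, hQ.ae_integrable hV hN hg,
    hQ.ae_integrable hV hN hk, hQ.ae_integrable hV hN (hf.mul hg),
    hQ.ae_integrable hV hN (hf.mul hk), hQ.ae_integrable hV hN (hg.mul hk),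
    hQ.ae_integrable hV hN ((hf.mul hg).mul hk)] with ω hω hfi hgi hki hfgi hfki hgki hfgki
  rw [hω] at hfi hgi hki hfgi hfki hgki hfgki ⊢
  exact tripleSum_sum_measure hfi hgi hki hfgi hfki hgki hfgki

theorem thirdFactorialCumulant_eq_integral_tripleSum (hf : IsTest f) (hg : IsTest g)
    (hk : IsTest k) :
    thirdFactorialCumulant N μ f g k = ∫ e, tripleSum (Q e) f g k ∂m := by
  have h₁ {a : ℝ → ℝ} (ha : IsTest a) : factorialMoment₁ N μ a = _ :=
    (hQ.hasExpectation_integral hV hN ha).2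
  have h₂ {a b : ℝ → ℝ} (ha : IsTest a) (hb : IsTest b) : factorialMoment₂ N μ a b = _ :=
    (hQ.hasExpectation_pairSum hV hN ha hb).2
  have h₃ : factorialMoment₃ N μ f g k = _ := (hQ.hasExpectation_tripleSum hV hN hf hg hk).2
  rw [thirdFactorialCumulant, h₃, h₂ hf hg, h₂ hf hk, h₂ hg hk, h₁ hf, h₁ hg, h₁ hk]
  ring

theorem lintegral_cube_lt_top {K : Set ℝ} (hK : IsCompact K) : ∫⁻ ω, (N ω K) ^ 3 ∂μ < ∞ := by
  have hf := IsTest.indicator_one hK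
  have hmass (ω : Ω) : ∫ x, K.indicator 1 x ∂N ω = (N ω).real K :=
    integral_indicator_one hK.measurableSet
  have hsq (x : ℝ) : K.indicator (1 : ℝ → ℝ) x * K.indicator 1 x = K.indicator 1 x := by
    by_cases hx : x ∈ K <;> simp [hx]
  have h₁ := (hQ.hasExpectation_integral hV hN hf).1
  have h₂ := (hQ.hasExpectation_pairSum hV hN hf hf).1
  have h₃ := (hQ.hasExpectation_tripleSum hV hN hf hf hf).1
  -- `x ^ 3 = x (x - 1) (x - 2) + 3 x (x - 1) + x` for the number `x` of points in `K`
  have hcube : Integrable (fun ω => (N ω).real K ^ 3) μ := by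
    refine ((h₃.add (h₂.const_mul 3)).add h₁).congr (.of_forall fun ω => ?_)
    simp only [Pi.add_apply, tripleSum, pairSum, hsq, hmass]
    ring
  refine (lintegral_congr_ae ?_).trans_lt hcube.2
  filter_upwards [hQ.ae_integrable hV hN hf] with ω hω
  have hfin : N ω K ≠ ∞ := by
    have hlt := hω.2
    simp only [HasFiniteIntegral, enorm_indicator_eq_indicator_enorm, Pi.one_apply, enorm_one,
      lintegral_indicator_const hK.measurableSet, one_mul] at hlt
    exact hlt.ne
  rw [enorm_pow, Measure.real, Real.enorm_of_nonneg ENNReal.toReal_nonneg,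
    ENNReal.ofReal_toReal hfin]

end Superposition

end HasCompactMoments

end CompactMoments

open Classical in
/-- The measure itself if it is finite, and `0` otherwise. Translating a measure is a jointly
measurable operation only on measures of bounded size, hence the truncation. -/
noncomputable def finitePart (c : Measure ℝ) : Measure ℝ := if c univ = ∞ then 0 else c

instance (c : Measure ℝ) : IsFiniteMeasure (finitePart c) := by
  rw [finitePart]
  split_ifs with h
  · infer_instance
  · exact ⟨lt_top_iff_ne_top.2 h⟩

theorem finitePart_of_ne_top {c : Measure ℝ} (h : c univ ≠ ∞) : finitePart c = c := if_neg h

theorem finitePart_le (c : Measure ℝ) : finitePart c ≤ c := by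
  rw [finitePart]
  split_ifs
  · exact Measure.zero_le c
  · exact le_rfl

theorem measurable_finitePart : Measurable finitePart :=
  .ite (Measure.measurable_coe .univ (measurableSet_singleton ∞)) measurable_const measurable_id

/-- The finite part of the measure `e.2`, translated by `e.1`. -/
noncomputable def shiftedCluster (e : ℝ × Measure ℝ) : Measure ℝ :=
  (finitePart e.2).map fun x => x + e.1

instance (e : ℝ × Measure ℝ) : IsFiniteMeasure (shiftedCluster e) := by
  rw [shiftedCluster]
  infer_instance

theorem measurable_shiftedCluster : Measurable shiftedCluster := by
  let κ : Kernel (ℝ × Measure ℝ) ℝ :=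
    ⟨fun e => finitePart e.2, measurable_finitePart.comp measurable_snd⟩
  refine Measure.measurable_of_measurable_coe _ fun s hs => ?_
  have ht : MeasurableSet {p : (ℝ × Measure ℝ) × ℝ | p.2 + p.1.1 ∈ s} :=
    (by fun_prop : Measurable fun p : (ℝ × Measure ℝ) × ℝ => p.2 + p.1.1) hs
  have hκ := Kernel.measurable_kernel_prodMk_left_of_finite (κ := κ) ht fun e =>
    inferInstanceAs (IsFiniteMeasure (finitePart e.2))
  convert hκ using 2 with e
  exact Measure.map_apply (by fun_prop) hs

theorem shiftedCluster_le_univ (e : ℝ × Measure ℝ) (K : Set ℝ) :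
    shiftedCluster e K ≤ e.2 univ := calc
  shiftedCluster e K ≤ shiftedCluster e univ := measure_mono (subset_univ K)
  _ = finitePart e.2 univ := by
    rw [shiftedCluster, Measure.map_apply (by fun_prop) .univ, preimage_univ]
  _ ≤ e.2 univ := finitePart_le _ _

theorem lintegral_map_add_right {G : Type*} [AddGroup G] [MeasurableSpace G] [MeasurableAdd₂ G]
    (ρ c : Measure G) [SFinite ρ] [ρ.IsAddLeftInvariant] [SFinite c] {K : Set G}
    (hK : MeasurableSet K) : ∫⁻ u, c.map (fun x => x + u) K ∂ρ = c univ * ρ K := by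
  have hK1 : Measurable (K.indicator (1 : G → ℝ≥0∞)) := measurable_one.indicator hK
  calc ∫⁻ u, c.map (fun x => x + u) K ∂ρ
      = ∫⁻ u, ∫⁻ x, K.indicator 1 (x + u) ∂c ∂ρ := by
        refine lintegral_congr fun u => ?_
        rw [← lintegral_indicator_one hK, lintegral_map hK1 (by fun_prop)]
    _ = ∫⁻ x, ∫⁻ u, K.indicator 1 (x + u) ∂ρ ∂c :=
        lintegral_lintegral_swap (hK1.comp (by fun_prop : Measurable fun p : G × G =>
          p.2 + p.1)).aemeasurable
    _ = ∫⁻ _, ρ K ∂c := by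
        refine lintegral_congr fun x => ?_
        rw [lintegral_add_left_eq_self (K.indicator 1) x, lintegral_indicator_one hK]
    _ = c univ * ρ K := by rw [lintegral_const, mul_comm]

theorem lintegral_shiftedCluster_pow_le (c : Measure ℝ) {K : Set ℝ} (hK : MeasurableSet K) {p : ℕ}
    (hp : p ≠ 0) : ∫⁻ u, shiftedCluster (u, c) K ^ p ≤ c univ ^ p * volume K := by
  obtain ⟨q, rfl⟩ := Nat.exists_eq_succ_of_ne_zero hp
  have hm : Measurable fun u => shiftedCluster (u, c) K :=
    (Measure.measurable_coe hK).comp (measurable_shiftedCluster.comp (by fun_prop))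
  calc ∫⁻ u, shiftedCluster (u, c) K ^ (q + 1)
      ≤ ∫⁻ u, c univ ^ q * shiftedCluster (u, c) K := by
        refine lintegral_mono fun u => ?_
        rw [pow_succ]
        exact mul_le_mul_left (pow_le_pow_left' (shiftedCluster_le_univ (u, c) K) q) _
    _ = c univ ^ q * (finitePart c univ * volume K) := by
        rw [lintegral_const_mul _ hm]
        exact congrArg _ (lintegral_map_add_right volume (finitePart c) hK)
    _ ≤ c univ ^ q * (c univ * volume K) := by gcongr; exact finitePart_le c
    _ = c univ ^ (q + 1) * volume K := by ring

theorem pow_le_one_add_pow (x : ℝ≥0∞) {p q : ℕ} (hpq : p ≤ q) : x ^ p ≤ 1 + x ^ q := by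
  rcases le_total x 1 with hx | hx
  · exact (pow_le_one₀ zero_le hx).trans le_self_add
  · exact (pow_le_pow_right₀ hx hpq).trans le_add_self

theorem hasCompactMoments_shiftedCluster (ν : ℝ≥0) (L : Measure (Measure ℝ)) [IsFiniteMeasure L]
    (hL : ∫⁻ c, c univ ^ 3 ∂L < ∞) :
    HasCompactMoments shiftedCluster ((ν • volume).prod L) where
  measurable := measurable_shiftedCluster
  finite := inferInstance
  moment_lt_top K hK p hp hp3 := by
    have hm : Measurable fun e => shiftedCluster e K ^ p :=
      ((Measure.measurable_coe hK.measurableSet).comp measurable_shiftedCluster).pow_const p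
    have hfin : (ν : ℝ≥0∞) * volume K < ∞ :=
      ENNReal.mul_lt_top ENNReal.coe_lt_top hK.measure_lt_top
    calc ∫⁻ e, shiftedCluster e K ^ p ∂(ν • volume).prod L
        = ∫⁻ c, ν * (∫⁻ u : ℝ, shiftedCluster (u, c) K ^ p) ∂L := by
          rw [lintegral_prod_symm' _ hm]
          simp only [lintegral_smul_measure, ENNReal.smul_def, smul_eq_mul]
      _ ≤ ∫⁻ c, ν * volume K * (1 + c univ ^ 3) ∂L := by
          refine lintegral_mono fun c => ?_
          rw [mul_assoc, mul_comm (volume K)]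
          gcongr
          exact (lintegral_shiftedCluster_pow_le c hK.measurableSet hp).trans <| by
            gcongr
            exact pow_le_one_add_pow _ hp3
      _ = ν * volume K * (L univ + ∫⁻ c, c univ ^ 3 ∂L) := by
          rw [lintegral_const_mul' _ _ hfin.ne, lintegral_add_left measurable_const, lintegral_one]
      _ < ∞ := ENNReal.mul_lt_top hfin (ENNReal.add_lt_top.2 ⟨measure_lt_top L univ, hL⟩)

theorem tripleSum_map_add_right (c : Measure ℝ) (u : ℝ) (f g h : ℝ → ℝ) :
    tripleSum (c.map fun x => x + u) f g h =
      tripleSum c (fun x => f (x + u)) (fun x => g (x + u)) (fun x => h (x + u)) := by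
  simp only [tripleSum, (measurableEmbedding_addRight u).integral_map]

namespace IsPoissonClusterSystem

variable {Ω₀ Ω : Type*} [MeasurableSpace Ω₀] [MeasurableSpace Ω] {P : Measure Ω₀} {μ : Measure Ω}
  {C₀ : Ω₀ → Measure ℝ} {ν : ℝ≥0} {U : ℕ → Ω → ℝ} {C : ℕ → Ω → Measure ℝ}

section Generator

variable (h : IsPoissonClusterSystem U C ν μ C₀ P) (hmoment : ∫⁻ ω, C₀ ω univ ^ 3 ∂P < ∞)

include h hmoment

theorem lintegral_law_cube_lt_top : ∫⁻ c, c univ ^ 3 ∂(P.map C₀) < ∞ := by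
  rwa [lintegral_map' ((Measure.measurable_coe .univ).pow_const 3).aemeasurable
    (h.identDistrib 0).aemeasurable_snd]

theorem ae_law_univ_ne_top : ∀ᵐ c ∂(P.map C₀), c univ ≠ ∞ := by
  filter_upwards [ae_lt_top ((Measure.measurable_coe .univ).pow_const 3)
    (h.lintegral_law_cube_lt_top hmoment).ne] with c hc htop
  simp [htop] at hc

theorem ae_clusterProcess_eq :
    ∀ᵐ ω ∂μ, clusterProcess U C ω = Measure.sum fun j => shiftedCluster (U j ω, C j ω) := by
  have hfin (j : ℕ) : ∀ᵐ ω ∂μ, C j ω univ ≠ ∞ := by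
    have hlaw := h.ae_law_univ_ne_top hmoment
    rw [← (h.identDistrib j).map_eq] at hlaw
    exact ae_of_ae_map (h.measurable_cluster j).aemeasurable hlaw
  filter_upwards [ae_all_iff.2 hfin] with ω hω
  simp only [clusterProcess, shiftedCluster, finitePart_of_ne_top (hω _)]

end Generator

variable [IsProbabilityMeasure P] [IsProbabilityMeasure μ]
  (h : IsPoissonClusterSystem U C ν μ C₀ P) (hmoment : ∫⁻ ω, C₀ ω univ ^ 3 ∂P < ∞) (hν : ν ≠ 0)

include h hmoment hν

theorem lintegral_clusterProcess_cube_lt_top {K : Set ℝ} (hK : IsCompact K) :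
    ∫⁻ ω, clusterProcess U C ω K ^ 3 ∂μ < ∞ := by
  have := Measure.isProbabilityMeasure_map (h.identDistrib 0).aemeasurable_snd
  exact (hasCompactMoments_shiftedCluster ν _
    (h.lintegral_law_cube_lt_top hmoment)).lintegral_cube_lt_top (h.hasPoissonFactorialMoments hν)
    (h.ae_clusterProcess_eq hmoment) hK

theorem thirdFactorialCumulant_eq_integral_tripleSum {f₀ f₁ f₂ : ℝ → ℝ} (h₀ : IsTest f₀)
    (h₁ : IsTest f₁) (h₂ : IsTest f₂) :
    thirdFactorialCumulant (clusterProcess U C) μ f₀ f₁ f₂ =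
      ν * ∫ u, ∫ ω, tripleSum (C₀ ω) (fun x => f₀ (x + u)) (fun x => f₁ (x + u))
        (fun x => f₂ (x + u)) ∂P := by
  have hC₀ := (h.identDistrib 0).aemeasurable_snd
  have := Measure.isProbabilityMeasure_map hC₀
  have hQ := hasCompactMoments_shiftedCluster ν _ (h.lintegral_law_cube_lt_top hmoment)
  rw [hQ.thirdFactorialCumulant_eq_integral_tripleSum (h.hasPoissonFactorialMoments hν)
    (h.ae_clusterProcess_eq hmoment) h₀ h₁ h₂, integral_prod _ (hQ.integrable_tripleSum h₀ h₁ h₂),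
    integral_smul_nnreal_measure, NNReal.smul_def, smul_eq_mul]
  congr 1
  refine integral_congr_ae (ae_of_all _ fun u => ?_)
  have hmeas : Measurable fun c => tripleSum (shiftedCluster (u, c)) f₀ f₁ f₂ :=
    (hQ.measurable_tripleSum h₀.measurable h₁.measurable h₂.measurable).comp
      (by fun_prop : Measurable fun c : Measure ℝ => (u, c))
  refine (integral_map hC₀ hmeas.aestronglyMeasurable).trans (integral_congr_ae ?_)
  filter_upwards [ae_of_ae_map hC₀ (h.ae_law_univ_ne_top hmoment)] with ω hω
  rw [shiftedCluster, finitePart_of_ne_top hω, tripleSum_map_add_right]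

end IsPoissonClusterSystem

section SubsetSums

theorem surjective_prod_of_linearIndependent {K V : Type*} [Field K] [AddCommGroup V] [Module K V]
    {f g : V →ₗ[K] K} (hfg : LinearIndependent K ![f, g]) : Function.Surjective (f.prod g) := by
  rw [← LinearMap.dualMap_injective_iff, injective_iff_map_eq_zero]
  intro φ hφ
  obtain ⟨h₁, h₂⟩ := LinearIndependent.pair_iff.1 hfg (φ (1, 0)) (φ (0, 1)) <| by
    ext x
    have hx : φ (f x • (1, 0) + g x • (0, 1)) = 0 := by simpa using LinearMap.congr_fun hφ x
    rw [map_add, map_smul, map_smul] at hx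
    simpa only [LinearMap.add_apply, LinearMap.smul_apply, smul_eq_mul, mul_comm,
      LinearMap.zero_apply] using hx
  ext <;> simpa

variable {ι K : Type*} [Fintype ι] [Field K]

open Classical in
/-- The linear form that sums the coordinates with index in `A`. -/
noncomputable def subsetSum (K : Type*) [Field K] (A : Set ι) : (ι → K) →ₗ[K] K :=
  ∑ i with i ∈ A, LinearMap.proj i

open Classical in
theorem subsetSum_apply (A : Set ι) (x : ι → K) : subsetSum K A x = ∑ i with i ∈ A, x i := by
  simp only [subsetSum, LinearMap.sum_apply, LinearMap.proj_apply]

open Classical in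
theorem subsetSum_single (A : Set ι) (i : ι) :
    subsetSum K A (Pi.single i 1) = if i ∈ A then 1 else 0 := by
  simp [subsetSum_apply, Pi.single_apply]

theorem linearIndependent_subsetSum_sub {A B C : Set ι} (hAB : A ≠ B) (hAC : A ≠ C)
    (hBC : B ≠ C) :
    LinearIndependent K
      ![subsetSum K B - subsetSum K A, subsetSum K C - subsetSum K A] := by
  classical
  rw [LinearIndependent.pair_iff]
  intro s t hst
  have hcoord (i : ι) : s * ((if i ∈ B then 1 else 0) - if i ∈ A then 1 else 0)
      + t * ((if i ∈ C then 1 else 0) - if i ∈ A then 1 else 0) = 0 := by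
    simpa only [LinearMap.add_apply, LinearMap.smul_apply, LinearMap.sub_apply, subsetSum_single,
      smul_eq_mul, LinearMap.zero_apply] using LinearMap.congr_fun hst (Pi.single i 1)
  have hcoef {X Y : Set ι} (hXY : X ≠ Y) {r : K}
      (hr : ∀ i, r * ((if i ∈ X then 1 else 0) - if i ∈ Y then 1 else 0) = 0) : r = 0 := by
    obtain ⟨i, hi⟩ := not_forall.1 fun h => hXY (Set.ext h)
    have hri := hr i
    grind
  obtain ⟨i, hi⟩ := not_forall.1 fun h => hAB (Set.ext h)
  have hsum := hcoord i
  -- `i` separates `A` from `B`, so `C` agrees at `i` with exactly one of them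
  obtain hs | hadd : s = 0 ∨ s + t = 0 := by grind
  · refine ⟨hs, hcoef hAC.symm fun j => ?_⟩
    simpa only [hs, zero_mul, zero_add] using hcoord j
  · have hs : s = 0 := hcoef hBC fun j => by
      linear_combination hcoord j - ((if j ∈ C then 1 else 0) - if j ∈ A then 1 else 0) * hadd
    exact ⟨hs, by simpa only [hs, zero_add] using hadd⟩

end SubsetSums

section AbsoluteContinuity

theorem pi_fin_absolutelyContinuous : ∀ {n : ℕ} {α : Fin n → Type*} [∀ i, MeasurableSpace (α i)]
    {p q : ∀ i, Measure (α i)} [∀ i, SigmaFinite (p i)] [∀ i, SigmaFinite (q i)],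
    (∀ i, p i ≪ q i) → Measure.pi p ≪ Measure.pi q
  | 0, _, _, p, q, _, _, _ => by rw [Measure.pi_of_empty p, Measure.pi_of_empty q]
  | n + 1, _, _, p, q, _, _, h => by
    have ih := pi_fin_absolutelyContinuous fun j => h (Fin.succAbove 0 j)
    rw [← (measurePreserving_piFinSuccAbove p 0).symm.map_eq,
      ← (measurePreserving_piFinSuccAbove q 0).symm.map_eq]
    exact ((h 0).prod ih).map (MeasurableEquiv.measurable _)

theorem pi_absolutelyContinuous {ι : Type*} [Fintype ι] {α : ι → Type*}
    [∀ i, MeasurableSpace (α i)] {p q : ∀ i, Measure (α i)} [∀ i, SigmaFinite (p i)]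
    [∀ i, SigmaFinite (q i)] (h : ∀ i, p i ≪ q i) : Measure.pi p ≪ Measure.pi q := by
  let e := (Fintype.equivFin ι).symm
  rw [← (measurePreserving_piCongrLeft p e).map_eq, ← (measurePreserving_piCongrLeft q e).map_eq]
  exact (pi_fin_absolutelyContinuous fun i => h (e i)).map (MeasurableEquiv.measurable _)

variable {Ω ι : Type*} [MeasurableSpace Ω] {P : Measure Ω} {Y : ι → Ω → ℝ}

theorem map_linear_absolutelyContinuous [Finite ι] [IsProbabilityMeasure P] {F : Type*}
    [NormedAddCommGroup F] [NormedSpace ℝ F] [MeasurableSpace F] [BorelSpace F]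
    (ρ : Measure F) [ρ.IsAddHaarMeasure] (hY : ∀ i, Measurable (Y i)) (hindep : iIndepFun Y P)
    (hac : ∀ i, P.map (Y i) ≪ volume) (L : (ι → ℝ) →ₗ[ℝ] F) (hL : Function.Surjective L) :
    P.map (fun ω => L fun i => Y i ω) ≪ ρ := by
  have := Fintype.ofFinite ι
  have hLm : Measurable L := L.continuous_of_finiteDimensional.measurable
  have (i : ι) : IsProbabilityMeasure (P.map (Y i)) :=
    Measure.isProbabilityMeasure_map (hY i).aemeasurable
  have hjoint : P.map (fun ω i => Y i ω) ≪ volume := by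
    rw [(iIndepFun_iff_map_fun_eq_pi_map fun i => (hY i).aemeasurable).1 hindep]
    exact pi_absolutelyContinuous hac
  obtain ⟨c, -, hc⟩ := L.exists_map_addHaar_eq_smul_addHaar volume ρ hL
  have himage := hjoint.map hLm
  rw [hc, Measure.map_map hLm (measurable_pi_lambda _ hY)] at himage
  exact himage.trans Measure.smul_absolutelyContinuous

theorem map_subsetSum_sub_absolutelyContinuous [Fintype ι] [IsProbabilityMeasure P]
    (hY : ∀ i, Measurable (Y i)) (hindep : iIndepFun Y P) (hac : ∀ i, P.map (Y i) ≪ volume)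
    {A B C : Set ι} (hAB : A ≠ B) (hAC : A ≠ C) (hBC : B ≠ C) :
    P.map (fun ω => (subsetSum ℝ B (Y · ω) - subsetSum ℝ A (Y · ω),
      subsetSum ℝ C (Y · ω) - subsetSum ℝ A (Y · ω))) ≪ volume :=
  map_linear_absolutelyContinuous volume hY hindep hac
    ((subsetSum ℝ B - subsetSum ℝ A).prod (subsetSum ℝ C - subsetSum ℝ A))
    (surjective_prod_of_linearIndependent (linearIndependent_subsetSum_sub hAB hAC hBC))

end AbsoluteContinuity

section Paths

variable {τ : Finset (List ℕ)}

theorem mem_of_isPrefix (hτ : ∀ (v : List ℕ) (i : ℕ), v ++ [i] ∈ τ → v ∈ τ) {u v : List ℕ}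
    (hv : v ∈ τ) (huv : u <+: v) : u ∈ τ := by
  induction v using List.reverseRecOn with
  | nil => rwa [List.prefix_nil.1 huv]
  | append_singleton v i ih =>
    rcases List.prefix_concat_iff.1 huv with rfl | h
    · exact hv
    · exact ih (hτ v i hv) h

instance (τ : Finset (List ℕ)) : Fintype {e : List ℕ // e ∈ τ ∧ e ≠ []} :=
  Fintype.subtype (τ.filter (· ≠ [])) (by simp)

/-- The edges on the path from the root to `v`, an edge being named after its lower endpoint. -/
def pathEdges (τ : Finset (List ℕ)) (v : List ℕ) : Set {e : List ℕ // e ∈ τ ∧ e ≠ []} :=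
  {e | e.1 <+: v}

theorem injOn_pathEdges : InjOn (pathEdges τ) τ := by
  have isPrefix_of_eq {v w : List ℕ} (hv : v ∈ τ) (h : pathEdges τ v = pathEdges τ w) :
      v <+: w := by
    by_cases hne : v = []
    · exact hne ▸ ⟨w, rfl⟩
    · have hmem : ⟨v, hv, hne⟩ ∈ pathEdges τ v := List.prefix_refl v
      rwa [h] at hmem
  intro v hv w hw h
  have hvw := isPrefix_of_eq hv h
  exact hvw.eq_of_length (hvw.length_le.antisymm (isPrefix_of_eq hw h.symm).length_le)

theorem position_eq_subsetSum (hτ : ∀ (v : List ℕ) (i : ℕ), v ++ [i] ∈ τ → v ∈ τ)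
    (D : List ℕ → ℝ) {v : List ℕ} (hv : v ∈ τ) :
    position D v = subsetSum ℝ (pathEdges τ v) fun e => D e := by
  classical
  have htake_ne {k : ℕ} (hk : k ∈ Finset.range v.length) : v.take (k + 1) ≠ [] := by
    have := Finset.mem_range.1 hk
    rw [← List.length_pos_iff, List.length_take]
    omega
  rw [subsetSum_apply, position]
  refine Finset.sum_bij'
    (fun k hk => ⟨v.take (k + 1), mem_of_isPrefix hτ hv ⟨_, List.take_append_drop _ _⟩,
      htake_ne hk⟩)
    (fun e _ => e.1.length - 1) (fun k _ => ?_) (fun e he => ?_) (fun k hk => ?_)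
    (fun e he => ?_) fun _ _ => rfl
  · exact Finset.mem_filter.2 ⟨Finset.mem_univ _, ⟨_, List.take_append_drop _ _⟩⟩
  · have hpre : e.1 <+: v := (Finset.mem_filter.1 he).2
    have := hpre.length_le
    have := List.length_pos_iff.2 e.2.2
    exact Finset.mem_range.2 (by omega)
  · have := Finset.mem_range.1 hk
    simp only [List.length_take]
    omega
  · have hpre : e.1 <+: v := (Finset.mem_filter.1 he).2
    refine Subtype.ext ?_
    simp only [Nat.sub_add_cancel (List.length_pos_iff.2 e.2.2)]
    exact (List.prefix_iff_eq_take.1 hpre).symm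

end Paths

namespace IsBranchingCluster

variable {Ω : Type*} [MeasurableSpace Ω] {T : Ω → Set (List ℕ)} {D : List ℕ → Ω → ℝ}
  {P : Measure Ω} (h : IsBranchingCluster T D P) {τ : Finset (List ℕ)}

include h

theorem parent_mem_of_measure_ne_zero (hτ : P {ω | T ω = (τ : Set (List ℕ))} ≠ 0)
    (v : List ℕ) (i : ℕ) (hv : v ++ [i] ∈ τ) : v ∈ τ := by
  obtain ⟨ω, hω, hparent⟩ :=
    ((frequently_ae_mem_iff.2 hτ).and_eventually h.parent_mem).exists
  simp only [mem_ofPred_eq] at hω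
  simpa [hω] using hparent v i (by simpa [hω] using hv)

theorem measurable_position (v : List ℕ) : Measurable fun ω => position (fun u => D u ω) v :=
  Finset.measurable_fun_sum _ fun _ _ => h.measurable_displacement _

theorem map_position_sub_absolutelyContinuous [IsFiniteMeasure P]
    (hτ : P {ω | T ω = (τ : Set (List ℕ))} ≠ 0) {u v w : List ℕ} (hu : u ∈ τ) (hv : v ∈ τ)
    (hw : w ∈ τ) (huv : u ≠ v) (huw : u ≠ w) (hvw : v ≠ w) :
    (P[|{ω | T ω = (τ : Set (List ℕ))}]).map (fun ω =>
      (position (fun e => D e ω) v - position (fun e => D e ω) u,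
        position (fun e => D e ω) w - position (fun e => D e ω) u)) ≪ volume := by
  have := cond_isProbabilityMeasure hτ
  have hp := h.parent_mem_of_measure_ne_zero hτ
  simp only [position_eq_subsetSum hp _ hu, position_eq_subsetSum hp _ hv,
    position_eq_subsetSum hp _ hw]
  exact map_subsetSum_sub_absolutelyContinuous
    (Y := fun e : {e : List ℕ // e ∈ τ ∧ e ≠ []} => D e)
    (fun e => h.measurable_displacement _) (h.indep τ hτ)
    (fun e => (h.density τ hτ e e.2.1 e.2.2).absolutelyContinuous)
    (injOn_pathEdges.ne hu hv huv) (injOn_pathEdges.ne hu hw huw) (injOn_pathEdges.ne hv hw hvw)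

end IsBranchingCluster

section LabelledPoints

variable {Ω ι E : Type*} [MeasurableSpace Ω] [MeasurableSpace E] {P : Measure Ω} {S : Ω → Set ι}

theorem measure_eq_zero_of_cond_eq_zero [Countable ι] [IsFiniteMeasure P] (hS : Measurable S)
    (hfin : ∀ᵐ ω ∂P, (S ω).Finite) {A : Set Ω}
    (hA : ∀ τ : Finset ι, P {ω | S ω = (τ : Set ι)} ≠ 0 →
      P[|{ω | S ω = (τ : Set ι)}] A = 0) : P A = 0 := by
  have hcover : A ⊆ {ω | ¬ (S ω).Finite} ∪ ⋃ τ : Finset ι, {ω | S ω = (τ : Set ι)} ∩ A := by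
    intro ω hω
    by_cases hSω : (S ω).Finite
    · obtain ⟨τ, hτ⟩ := hSω.exists_finset_coe
      exact Or.inr (mem_iUnion.2 ⟨τ, hτ.symm, hω⟩)
    · exact Or.inl hSω
  refine measure_mono_null hcover (measure_union_null hfin (measure_iUnion_null fun τ => ?_))
  by_cases hτ : P {ω | S ω = (τ : Set ι)} = 0
  · exact measure_mono_null inter_subset_left hτ
  · have hSτ : MeasurableSet {ω | S ω = (τ : Set ι)} := hS (measurableSet_singleton _)
    have hcond := hA τ hτ
    rw [cond_apply hSτ] at hcond
    exact (mul_eq_zero.1 hcond).resolve_left (ENNReal.inv_ne_zero.2 (measure_ne_top P _))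

variable {n : ℕ} {X : ι → Ω → E}

theorem map_factorialMomentMeasure_absolutelyContinuous [Countable ι] [IsFiniteMeasure P]
    (hS : Measurable S) (hX : ∀ i, Measurable (X i)) (hfin : ∀ᵐ ω ∂P, (S ω).Finite) {F : Type*}
    [MeasurableSpace F] {ρ : Measure F} {φ : (Fin n → E) → F} (hφ : Measurable φ)
    (hac : ∀ τ : Finset ι, P {ω | S ω = (τ : Set ι)} ≠ 0 → ∀ p : Fin n ↪ ι, (∀ i, p i ∈ τ) →
      (P[|{ω | S ω = (τ : Set ι)}]).map (fun ω => φ fun i => X (p i) ω) ≪ ρ) :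
    (factorialMomentMeasure n S X P).map φ ≪ ρ := by
  refine Measure.AbsolutelyContinuous.mk fun B hB hρB => ?_
  rw [Measure.map_apply hφ hB, factorialMomentMeasure, Measure.sum_apply_eq_zero' (hφ hB)]
  intro p
  rw [Measure.map_apply (measurable_tuple hX p) (hφ hB),
    Measure.restrict_apply (measurable_tuple hX p (hφ hB))]
  refine measure_eq_zero_of_cond_eq_zero hS hfin fun τ hτ => ?_
  by_cases hp : ∀ i, p i ∈ τ
  · have hnull := hac τ hτ p hp hρB
    rw [← Function.comp_def, Measure.map_apply (hφ.comp (measurable_tuple hX p)) hB] at hnull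
    exact measure_mono_null inter_subset_left hnull
  · have hSτ : MeasurableSet {ω | S ω = (τ : Set ι)} := hS (measurableSet_singleton _)
    rw [cond_apply hSτ]
    refine mul_eq_zero_of_right _ (measure_mono_null ?_ measure_empty)
    rintro ω ⟨hSω, -, hmem⟩
    rw [mem_ofPred_eq] at hSω
    exact hp fun i => by simpa only [hSω, Finset.mem_coe] using hmem i

theorem encard_embedding_into_le (n : ℕ) (s : Set ι) :
    {p : Fin n ↪ ι | ∀ i, p i ∈ s}.encard ≤ s.encard ^ n := by
  have hpi := encard_pi_eq_prod_encard (s := fun _ : Fin n => s)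
  rw [Finset.prod_const, Finset.card_univ, Fintype.card_fin] at hpi
  rw [← hpi]
  exact encard_le_encard_of_injOn (fun p hp i _ => hp i) DFunLike.coe_injective.injOn

theorem factorialMomentMeasure_apply_univ_le [Countable ι] (hS : Measurable S)
    (hX : ∀ i, Measurable (X i)) :
    factorialMomentMeasure n S X P univ ≤
      ∫⁻ ω, (Measure.sum fun v : S ω => Measure.dirac (X v ω)) univ ^ n ∂P := by
  rw [factorialMomentMeasure_apply hS hX MeasurableSet.univ]
  refine lintegral_mono fun ω => ?_
  rw [sum_dirac_apply _ MeasurableSet.univ]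
  simp only [mem_univ, and_true, ofPred_true, encard_univ, ← ENat.toENNReal_pow]
  exact ENat.toENNReal_le.2 (encard_embedding_into_le n (S ω))

end LabelledPoints

section LabelledClusters

theorem integral_sum_dirac {ι : Type*} {S : Set ι} (hS : S.Finite) (x : ι → ℝ) (φ : ℝ → ℝ) :
    ∫ y, φ y ∂(Measure.sum fun v : S => Measure.dirac (x v)) =
      ∑' v, S.indicator (fun v => φ (x v)) v := by
  have := hS.fintype
  rw [Measure.sum_fintype, integral_finsetSum_measure fun _ _ => integrable_dirac (by simp),
    ← tsum_subtype, tsum_fintype]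
  exact Finset.sum_congr rfl fun v _ => integral_dirac _ _

theorem hasSum_tripleSum {ι : Type*} {S : Set ι} (hS : S.Finite) (x : ι → ℝ) (f g h : ℝ → ℝ) :
    HasSum (fun p : Fin 3 ↪ ι => {p : Fin 3 ↪ ι | ∀ i, p i ∈ S}.indicator
        (fun p => f (x (p 0)) * g (x (p 1)) * h (x (p 2))) p)
      (tripleSum (Measure.sum fun v : S => Measure.dirac (x v)) f g h) := by
  have hsummable (φ : ι → ℝ) : Summable (S.indicator φ) :=
    summable_of_hasFiniteSupport (hS.subset support_indicator_subset)
  simp only [tripleSum, integral_sum_dirac hS, indicator_mul]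
  convert hasSum_embedding_three (hsummable fun v => f (x v)) (hsummable fun v => g (x v))
    (hsummable fun v => h (x v)) using 2 with p
  by_cases h₀ : p 0 ∈ S <;> by_cases h₁ : p 1 ∈ S <;> by_cases h₂ : p 2 ∈ S <;>
    simp [Fin.forall_fin_succ, h₀, h₁, h₂]

variable {Ω ι : Type*} [MeasurableSpace Ω] [Countable ι] {P : Measure Ω} {S : Ω → Set ι}
  {X : ι → Ω → ℝ}

theorem integral_tripleSum_sum_dirac (hS : Measurable S) (hX : ∀ i, Measurable (X i))
    (hfin : ∀ᵐ ω ∂P, (S ω).Finite) [IsFiniteMeasure (factorialMomentMeasure 3 S X P)]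
    {f g h : ℝ → ℝ} (hf : Measurable f) (hg : Measurable g) (hh : Measurable h)
    (hf' : ∃ b, ∀ x, |f x| ≤ b) (hg' : ∃ b, ∀ x, |g x| ≤ b) (hh' : ∃ b, ∀ x, |h x| ≤ b) :
    ∫ ω, tripleSum (Measure.sum fun v : S ω => Measure.dirac (X v ω)) f g h ∂P =
      ∫ x, f (x 0) * g (x 1) * h (x 2) ∂factorialMomentMeasure 3 S X P := by
  obtain ⟨a, ha⟩ := hf'
  obtain ⟨b, hb⟩ := hg'
  obtain ⟨c, hc⟩ := hh'
  have hm : Measurable fun x : Fin 3 → ℝ => f (x 0) * g (x 1) * h (x 2) := by fun_prop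
  have hcoord {φ : ℝ → ℝ} (hφ : Measurable φ) (i : Fin 3) :
      AEStronglyMeasurable (fun x => φ (x i)) (factorialMomentMeasure 3 S X P) :=
    (hφ.comp (measurable_pi_apply i)).aestronglyMeasurable
  have hi : Integrable (fun x : Fin 3 → ℝ => f (x 0) * g (x 1) * h (x 2))
      (factorialMomentMeasure 3 S X P) :=
    ((Integrable.of_bound (hcoord hf 0) a (ae_of_all _ fun x => ha (x 0))).mul_bdd (c := b)
      (hcoord hg 1) (ae_of_all _ fun x => hb (x 1))).mul_bdd (c := c)
      (hcoord hh 2) (ae_of_all _ fun x => hc (x 2))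
  rw [← integral_tsum_indicator_tuple hS hX hm hi]
  refine integral_congr_ae ?_
  filter_upwards [hfin] with ω hω
  exact (hasSum_tripleSum hω (fun v => X v ω) f g h).tsum_eq.symm

end LabelledClusters

section Differences

theorem integral_integral_add_left {α : Type*} [MeasurableSpace α] (Λ : Measure α) [SFinite Λ]
    {G : α × ℝ → ℝ} (hG : Integrable G (Λ.prod volume)) {a : α → ℝ} (ha : Measurable a) :
    ∫ u, ∫ x, G (x, a x + u) ∂Λ = ∫ t, ∫ x, G (x, t) ∂Λ := by
  have hshear : MeasurePreserving (fun p : α × ℝ => (p.1, a p.1 + p.2)) (Λ.prod volume)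
      (Λ.prod volume) :=
    (MeasurePreserving.id Λ).skew_product (g := fun x u => a x + u) (by fun_prop)
      (ae_of_all _ fun x => map_add_left_eq_self volume (a x))
  rw [← integral_integral_swap (f := fun x u => G (x, a x + u))
      (hshear.integrable_comp_of_integrable hG),
    ← integral_integral_swap (f := fun x u => G (x, u)) hG]
  exact integral_congr_ae (ae_of_all _ fun x => integral_add_left_eq_self (fun u => G (x, u)) _)

/-- The position of a triple of points relative to the first of them. -/
def differences (x : Fin 3 → ℝ) : ℝ × ℝ := (x 1 - x 0, x 2 - x 0)

theorem measurable_differences : Measurable differences := by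
  unfold differences
  fun_prop

theorem integral_integral_translate (Λ : Measure (Fin 3 → ℝ)) [IsFiniteMeasure Λ] {f g h : ℝ → ℝ}
    (hf : IsTest f) (hg : IsTest g) (hh : IsTest h) :
    ∫ u, ∫ x, f (x 0 + u) * g (x 1 + u) * h (x 2 + u) ∂Λ =
      ∫ t, ∫ τ, f t * g (t + τ.1) * h (t + τ.2) ∂Λ.map differences := by
  obtain ⟨b, hb⟩ := hg.bounded
  obtain ⟨c, hc⟩ := hh.bounded
  have := hf.measurable
  have := hg.measurable
  have := hh.measurable
  have hd := measurable_differences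
  have hG : Integrable (fun p : (Fin 3 → ℝ) × ℝ => f p.2 * g (p.2 + (differences p.1).1) *
      h (p.2 + (differences p.1).2)) (Λ.prod volume) :=
    (((hf.integrable volume).comp_snd Λ).mul_bdd (c := b)
      (by fun_prop : Measurable _).aestronglyMeasurable (ae_of_all _ fun p => hb _)).mul_bdd
      (c := c) (by fun_prop : Measurable _).aestronglyMeasurable (ae_of_all _ fun p => hc _)
  have hshear := integral_integral_add_left Λ hG (measurable_pi_apply (0 : Fin 3))
  have hmap (t : ℝ) : ∫ τ, f t * g (t + τ.1) * h (t + τ.2) ∂Λ.map differences =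
      ∫ x, f t * g (t + (differences x).1) * h (t + (differences x).2) ∂Λ :=
    integral_map hd.aemeasurable (by fun_prop : Measurable _).aestronglyMeasurable
  have hcancel (x : Fin 3 → ℝ) (u : ℝ) (i : Fin 3) : x 0 + u + (x i - x 0) = x i + u := by ring
  simp only [differences, hcancel] at hshear
  simp only [hmap, differences, hshear]

end Differences

theorem tripleSum_one (N : Measure ℝ) :
    tripleSum N 1 1 1 = (N univ).toReal * ((N univ).toReal - 1) * ((N univ).toReal - 2) := by
  simp only [tripleSum, Pi.one_apply, mul_one, integral_const, smul_eq_mul, measureReal_def]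
  ring

theorem toSignedMeasure_eq_withDensityᵥ {α : Type*} [MeasurableSpace α] {ρ m : Measure α}
    [IsFiniteMeasure ρ] [SigmaFinite m] (h : ρ ≪ m) :
    ρ.toSignedMeasure = m.withDensityᵥ fun x => (ρ.rnDeriv m x).toReal := by
  ext s hs
  rw [withDensityᵥ_apply Measure.integrable_toReal_rnDeriv hs,
    Measure.setIntegral_toReal_rnDeriv h, Measure.toSignedMeasure_apply_measurable hs]

section LabelledGenerator

variable {Ω₀ Ω ι : Type*} [MeasurableSpace Ω₀] [MeasurableSpace Ω] [Countable ι]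
  {P : Measure Ω₀} {S : Ω₀ → Set ι} {X : ι → Ω₀ → ℝ}

theorem measureReal_map_differences_univ (hS : Measurable S) (hX : ∀ i, Measurable (X i))
    (hfin : ∀ᵐ ω ∂P, (S ω).Finite) [IsFiniteMeasure (factorialMomentMeasure 3 S X P)] :
    ((factorialMomentMeasure 3 S X P).map differences).real univ =
      ∫ ω, ((Measure.sum fun v : S ω => Measure.dirac (X v ω)) univ).toReal
        * (((Measure.sum fun v : S ω => Measure.dirac (X v ω)) univ).toReal - 1)
        * (((Measure.sum fun v : S ω => Measure.dirac (X v ω)) univ).toReal - 2) ∂P := by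
  have hone : ∃ b, ∀ x : ℝ, |(1 : ℝ → ℝ) x| ≤ b := ⟨1, fun x => by simp⟩
  have htriple := integral_tripleSum_sum_dirac hS hX hfin measurable_one measurable_one
    measurable_one hone hone hone
  simp only [tripleSum_one] at htriple
  rw [htriple, map_measureReal_apply measurable_differences MeasurableSet.univ]
  simp

theorem IsPoissonClusterSystem.isReducedThirdFactorialCumulant [IsProbabilityMeasure P]
    {μ : Measure Ω} [IsProbabilityMeasure μ] {ν : ℝ≥0} {U : ℕ → Ω → ℝ} {C : ℕ → Ω → Measure ℝ}
    (h : IsPoissonClusterSystem U C ν μ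
      (fun ω => Measure.sum fun v : S ω => Measure.dirac (X v ω)) P)
    (hmoment : ∫⁻ ω, (Measure.sum fun v : S ω => Measure.dirac (X v ω)) univ ^ 3 ∂P < ∞)
    (hν : ν ≠ 0) (hS : Measurable S) (hX : ∀ i, Measurable (X i))
    (hfin : ∀ᵐ ω ∂P, (S ω).Finite) [IsFiniteMeasure (factorialMomentMeasure 3 S X P)] :
    IsReducedThirdFactorialCumulant (clusterProcess U C) μ
      (ν • (factorialMomentMeasure 3 S X P).map differences).toSignedMeasure where
  moment_lt_top _ hK := h.lintegral_clusterProcess_cube_lt_top hmoment hν hK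
  disintegration f₀ f₁ f₂ h₀ h₁ h₂ := by
    have htranslate {f : ℝ → ℝ} (hf : IsTest f) (u : ℝ) :
        Measurable (fun x => f (x + u)) ∧ ∃ b, ∀ x, |f (x + u)| ≤ b :=
      ⟨hf.measurable.comp (measurable_add_const u), hf.bounded.imp fun b hb x => hb _⟩
    have htriple (u : ℝ) := integral_tripleSum_sum_dirac hS hX hfin (htranslate h₀ u).1
      (htranslate h₁ u).1 (htranslate h₂ u).1 (htranslate h₀ u).2 (htranslate h₁ u).2
      (htranslate h₂ u).2
    rw [h.thirdFactorialCumulant_eq_integral_tripleSum hmoment hν h₀ h₁ h₂]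
    simp only [htriple, VectorMeasure.integral_toSignedMeasure, integral_smul_nnreal_measure,
      NNReal.smul_def, smul_eq_mul, integral_const_mul]
    rw [integral_integral_translate _ h₀ h₁ h₂]

end LabelledGenerator

theorem IsBranchingCluster.map_differences_absolutelyContinuous {Ω : Type*} [MeasurableSpace Ω]
    {T : Ω → Set (List ℕ)} {D : List ℕ → Ω → ℝ} {P : Measure Ω} [IsFiniteMeasure P]
    (h : IsBranchingCluster T D P) :
    (factorialMomentMeasure 3 T (fun v ω => position (fun u => D u ω) v) P).map differences ≪
      volume :=
  map_factorialMomentMeasure_absolutelyContinuous h.measurable_tree h.measurable_position h.finite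
    measurable_differences fun _ hτ p hp => h.map_position_sub_absolutelyContinuous hτ (hp 0)
      (hp 1) (hp 2) (p.injective.ne (by decide)) (p.injective.ne (by decide))
      (p.injective.ne (by decide))

end PoissonCluster

theorem mainTheorem7 {Ω₀ Ω : Type*} [MeasurableSpace Ω₀] [MeasurableSpace Ω]
    (P : Measure Ω₀) [IsProbabilityMeasure P] (μ : Measure Ω) [IsProbabilityMeasure μ]
    (T : Ω₀ → Set (List ℕ)) (D : List ℕ → Ω₀ → ℝ)
    (hC : PoissonCluster.IsBranchingCluster T D P)
    (hmoment : ∫⁻ ω, (PoissonCluster.cluster T D ω univ) ^ 3 ∂P < ∞)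
    (ν : ℝ≥0) (hν : 0 < ν) (U : ℕ → Ω → ℝ) (C : ℕ → Ω → Measure ℝ)
    (hN : PoissonCluster.IsPoissonClusterSystem U C ν μ (PoissonCluster.cluster T D) P) :
    ∃ κ : SignedMeasure (ℝ × ℝ),
      PoissonCluster.IsReducedThirdFactorialCumulant (PoissonCluster.clusterProcess U C) μ κ ∧
      ∃ c₃ : ℝ × ℝ → ℝ, Integrable c₃ volume ∧
        κ = (volume : Measure (ℝ × ℝ)).withDensityᵥ c₃ ∧
        ∫ τ, c₃ τ = ν * ∫ ω, (PoissonCluster.cluster T D ω univ).toReal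
          * ((PoissonCluster.cluster T D ω univ).toReal - 1)
          * ((PoissonCluster.cluster T D ω univ).toReal - 2) ∂P := by
  let X (v : List ℕ) (ω : Ω₀) : ℝ := PoissonCluster.position (fun u => D u ω) v
  have hT : Measurable T := hC.measurable_tree
  have hX : ∀ v, Measurable (X v) := hC.measurable_position
  have hfinite : IsFiniteMeasure (PoissonCluster.factorialMomentMeasure 3 T X P) :=
    ⟨(PoissonCluster.factorialMomentMeasure_apply_univ_le hT hX).trans_lt hmoment⟩
  have hac : ν • (PoissonCluster.factorialMomentMeasure 3 T X P).map PoissonCluster.differences ≪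
      volume := hC.map_differences_absolutelyContinuous.smul_left ν
  refine ⟨_, hN.isReducedThirdFactorialCumulant (X := X) hmoment hν.ne' hT hX hC.finite, _,
    Measure.integrable_toReal_rnDeriv, PoissonCluster.toSignedMeasure_eq_withDensityᵥ hac, ?_⟩
  rw [Measure.integral_toReal_rnDeriv hac, measureReal_nnreal_smul_apply]
  exact congrArg _ (PoissonCluster.measureReal_map_differences_univ hT hX hC.finite)
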